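/- **Setting.** Let $k$ be a field, $k_q=k[q,q^{-1}]$ with $q$ an indeterminate, and let $\mathcal O_q(M_n(k))$ be the $k_q$-algebra generated by $x_{ij}$, $1\le i,j\le n$, with the Manin relations $$x_{ij}x_{il}=q^{-1}x_{il}x_{ij},\quad x_{ji}x_{li}=q^{-1}x_{li}x_{ji}\quad (j<l),\qquad x_{ij}x_{rl}=x_{rl}x_{ij}\quad (i<r,\ j>l\ \text{ or }\ i>r,\ j<l),$$ $$x_{ij}x_{rl}-x_{rl}x_{ij}=(q^{-1}-q)\,x_{rj}x_{il}\quad (i<r,\ j<l).$$ For a sequence $Z=(z_1,\dots,z_r)$ of distinct row indices and a set $J$ of $r$ column indices put $$[Z,J]=\sum_{w}(-q)^{-l(w)}x_{z_1w_1}\cdots x_{z_rw_r},$$ the sum being over all bijections $w$ from $\{1,\dots,r\}$ onto $J$, with $l(w)$ the number of inversions of $(w_1,\dots,w_r)$. A set of rows is regarded as the corresponding increasing sequence; $[I,J]$ is then the usual quantum minor. For a sequence $W$ with distinct entries, $l(W)$ denotes its number of inversions; $(W\cup C)_{ord}$ is the set of the entries of $W$ and the elements of $C$, in increasing order. **Standard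 towers.** Let $U$ be a finite ordered set. For $I\subseteq U$ not an initial segment, let $b$ be the smallest element of $I$ that has an immediate predecessor $a$ in $U$ with $a\notin I$; replacing $b$ by $a$, that is, applying the transposition $(a,b)$, and repeating, one gets the standard row tower $I=I_N>\dots>I_0$, with $I_0$ the initial segment of $U$ of size $|I|$ and $\sigma^r_tI_t=I_{t-1}$. For $J\subseteq U$ not a final segment, let $a$ be the largest element of $J$ that has an immediate successor $b$ in $U$ with $b\notin J$; replacing $a$ by $b$ and repeating, one gets the standard column tower $J=J_M<\dots<J_0$, with $J_0$ the final segment of $U$ of size $|J|$ and $\sigma^c_sJ_s=J_{s-1}$. **The lists $C_i$.** Let $I\subseteq U$ and $J\subseteq V$, with the standard row tower of $I$ in $U$ and the standard column tower of $J$ in $V$. The lists $C_i$ below consist of pairs $(Z,W)$ of sequences, carried along with complementary sequences $Z'$ (of $Z$ in $U$) and $W'$ (of $W$ in $V$); entries may repeat, and each entry has its own sign. Start with $C_0^{I_0,J_0}$ consisting of $(I_0,J_0)$ only (with $I_0',J_0'$ increasing), and $C_i^{I_0,J_0}=\emptyset$ for $i\neq0$. For $1\le s\le M$ and $\sigma_s^c=(a,b)$,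 $a<b$, the list $C_i^{I_0,J_s}$ consists of those entries of $C_{i-1}^{I_0,J_{s-1}}$ for which $a$ does not stand before $b$ in the sequence $(W,W')$, followed by all entries of $C_i^{I_0,J_{s-1}}$ with $a$ and $b$ exchanged in $(W,W')$. Every entry of $C_i^{I_0,J_M}$ has the sign $(-1)^i$. For $1\le t\le N$ and $\sigma_t^r=(a,b)$, $a<b$, the list $C_i^{I_t,J_M}$ consists of those entries of $C_{i-1}^{I_{t-1},J_M}$ for which $b$ does not stand before $a$ in the sequence $(Z,Z')$, followed by all entries of $C_i^{I_{t-1},J_M}$ with $a$ and $b$ exchanged in $(Z,Z')$; entries keep their signs. (Lists with negative lower index are empty.) Put $C_i^{I,J}=C_i^{I_N,J_M}$. **Theorem.** Let $I,J,K,L\subseteq\{1,\dots,n\}$ with $|I|=|J|$, $|K|=|L|$ and $I\cap K=\emptyset$, and let $C=J\cap L$, $z=|C|$. Let $N$ be the length of the standard row tower of $I$ in $I\cup K$, $M$ the length of the standard column tower of $J\setminus C$ in $(J\cup L)\setminus C$, and let $C_i^{I,J\setminus C}$ be formed with these two towers. Then in $\mathcal O_q(M_n(k))$ $$q^{-z}[K,L][I,J]=\sum_{i=0}^{M+N}(q^{-1}-q)^i\sum_{(Z,W)\in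 C_i^{I,J\setminus C}}\operatorname{sign}(Z,W)\,(-q)^{-l(W)-l(W')}\,[Z,(W\cup C)_{ord}]\,[Z',(W'\cup C)_{ord}].$$ -/

import Mathlib

namespace QuantumMinor

/-! ### The quantum matrix bialgebra over `k[q, q⁻¹]` (with `q = LaurentPolynomial.T 1`) -/

section Algebra

variable (k : Type*) [Field k] (n : ℕ)

/-- The free algebra over `k[q, q⁻¹]` on the indeterminates `a_{ij}`, `i, j = 1, …, n`. -/
abbrev FreeMat : Type _ := FreeAlgebra (LaurentPolynomial k) (Fin n × Fin n)

variable {n}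

/-- The indeterminate `a_{ij}` of the free algebra. -/
noncomputable def gen (i j : Fin n) : FreeMat k n :=
  FreeAlgebra.ι (LaurentPolynomial k) (i, j)

variable (n)

/-- The Manin relations. -/
inductive ManinRel : FreeMat k n → FreeMat k n → Prop
  | row (i j l : Fin n) (h : j < l) :
      ManinRel (gen k i j * gen k i l)
        ((LaurentPolynomial.T (-1) : LaurentPolynomial k) • (gen k i l * gen k i j))
  | col (i j l : Fin n) (h : j < l) :
      ManinRel (gen k j i * gen k l i)
        ((LaurentPolynomial.T (-1) : LaurentPolynomial k) • (gen k l i * gen k j i))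
  | comm (i j r l : Fin n) (h : (i < r ∧ l < j) ∨ (r < i ∧ j < l)) :
      ManinRel (gen k i j * gen k r l) (gen k r l * gen k i j)
  | cross (i j r l : Fin n) (hr : i < r) (hc : j < l) :
      ManinRel (gen k i j * gen k r l - gen k r l * gen k i j)
        ((LaurentPolynomial.T (-1) - LaurentPolynomial.T 1 : LaurentPolynomial k) •
          (gen k r j * gen k i l))

/-- The quantum matrix bialgebra `O_q(M_n(k))`, as an algebra over `k[q, q⁻¹]`: the quotient of
the free algebra by the two-sided ideal generated by the Manin relations. -/
abbrev QMat : Type _ := RingQuot (ManinRel k n)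

variable {n}

/-- The generator `x_{ij}` of `O_q(M_n(k))`. -/
noncomputable def x (i j : Fin n) : QMat k n :=
  RingQuot.mkAlgHom (LaurentPolynomial k) (ManinRel k n) (gen k i j)

/-- The number of inversions of a finite sequence, that is, for a sequence with distinct entries,
the length of the permutation that sorts it. -/
def inversions {α : Type*} [LinearOrder α] {m : ℕ} (w : Fin m → α) : ℕ :=
  (Finset.univ.filter fun p : Fin m × Fin m => p.1 < p.2 ∧ w p.2 < w p.1).card

/-- The quantum (row) minor `[Z, J]`, with row sequence `Z = (z_1, …, z_r)` and column set `J`,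
`|J| = r`: the sum of `(-q)^{-l(w)} x_{z_1 w_1} ⋯ x_{z_r w_r}` over the bijections `w` from
`{1, …, r}` onto `J`. If `Z` is increasing this is the usual quantum minor; if `Z` is not
increasing, the factors stand in the order of `Z`. -/
noncomputable def minor (Z : List (Fin n)) (J : Finset (Fin n)) : QMat k n :=
  ∑ w : Fin Z.length → Fin n with Function.Injective w ∧ Finset.univ.image w = J,
    (-(LaurentPolynomial.T (-1)) : LaurentPolynomial k) ^ inversions w •
      (List.ofFn fun i => x k (Z.get i) (w i)).prod

end Algebra

/-! ### Standard towers and the index sets `C_i` -/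

section Combinatorics

variable {α : Type*} [LinearOrder α]

/-- The pairs of consecutive elements of `U`, in increasing order. -/
def consecutive (U : Finset α) : List (α × α) := U.sort.zip U.sort.tail

/-- The standard row transposition `(a, b)` of `I` in `U`: `b` is the first element of `I` whose
predecessor `a` in `U` exists and is not in `I`. There is none exactly if `I` is an initial
segment of `U`. -/
def rowTransposition (U I : Finset α) : Option (α × α) :=
  (consecutive U).find? fun p => p.1 ∉ I ∧ p.2 ∈ I

/-- The standard column transposition `(a, b)` of `J` in `U`: `a` is the last element of `J` whose
successor `b` in `U` exists and is not in `J`. There is none exactly if `J` is a final segment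
of `U`. -/
def colTransposition (U J : Finset α) : Option (α × α) :=
  (consecutive U).reverse.find? fun p => p.1 ∈ J ∧ p.2 ∉ J

theorem lt_of_mem_consecutive {U : Finset α} {p : α × α} (h : p ∈ consecutive U) :
    p.1 ∈ U ∧ p.2 ∈ U ∧ p.1 < p.2 := by
  have key : ∀ l : List α, l.Pairwise (· < ·) → p ∈ l.zip l.tail →
      p.1 ∈ l ∧ p.2 ∈ l ∧ p.1 < p.2 := by
    intro l
    induction l with
    | nil => simp
    | cons a l ih =>
      cases l with
      | nil => simp
      | cons b l =>
        intro hs hp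
        rw [List.tail_cons, List.zip_cons_cons, List.mem_cons] at hp
        rcases hp with rfl | hp
        · exact ⟨by simp, by simp, (List.pairwise_cons.1 hs).1 b (by simp)⟩
        · obtain ⟨h1, h2, h3⟩ := ih (List.pairwise_cons.1 hs).2 hp
          exact ⟨List.mem_cons_of_mem _ h1, List.mem_cons_of_mem _ h2, h3⟩
  have h0 := key (U.sort (· ≤ ·)) U.sortedLT_sort.pairwise h
  simpa using h0

theorem rowTransposition_spec {U I : Finset α} {p : α × α}
    (h : rowTransposition U I = some p) :
    p.1 ∈ U ∧ p.2 ∈ U ∧ p.1 < p.2 ∧ p.1 ∉ I ∧ p.2 ∈ I := by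
  have h1 := lt_of_mem_consecutive (List.mem_of_find?_eq_some h)
  have h2 := List.find?_some h
  simp only [decide_eq_true_eq] at h2
  exact ⟨h1.1, h1.2.1, h1.2.2, h2.1, h2.2⟩

theorem colTransposition_spec {U J : Finset α} {p : α × α}
    (h : colTransposition U J = some p) :
    p.1 ∈ U ∧ p.2 ∈ U ∧ p.1 < p.2 ∧ p.1 ∈ J ∧ p.2 ∉ J := by
  have h1 := lt_of_mem_consecutive (List.mem_reverse.1 (List.mem_of_find?_eq_some h))
  have h2 := List.find?_some h
  simp only [decide_eq_true_eq] at h2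
  exact ⟨h1.1, h1.2.1, h1.2.2, h2.1, h2.2⟩

/-- The list `σ_N, …, σ_1` of the transpositions of the standard row tower
`I = I_N > I_{N-1} > ⋯ > I_0` of `I` in `U`, where `I_0` is the initial segment of `U` with `|I|`
elements. Its length `N` is the row intertwining order of `I` in `U`. -/
def rowTower (U I : Finset α) : List (α × α) :=
  match _h : rowTransposition U I with
  | none => []
  | some p => p :: rowTower U (insert p.1 (I.erase p.2))
termination_by ∑ i ∈ I, (U.filter (· < i)).card
decreasing_by
  obtain ⟨h1, _, h3, h4, h5⟩ := rowTransposition_spec _h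
  rw [Finset.sum_insert (fun h => h4 (Finset.mem_of_mem_erase h)),
    ← Finset.add_sum_erase I _ h5]
  refine Nat.add_lt_add_right (Finset.card_lt_card ?_) _
  refine Finset.ssubset_iff_subset_ne.2 ⟨fun c hc => ?_, fun he => ?_⟩
  · simp only [Finset.mem_filter] at hc ⊢
    exact ⟨hc.1, hc.2.trans h3⟩
  · have : p.1 ∈ U.filter (· < p.2) := by simp [h1, h3]
    rw [← he] at this
    simp at this

/-- The list `σ_M, …, σ_1` of the transpositions of the standard column tower
`J = J_M < J_{M-1} < ⋯ < J_0` of `J` in `U`, where `J_0` is the final segment of `U` with `|J|`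
elements. Its length `M` is the column intertwining order of `J` in `U`. -/
def colTower (U J : Finset α) : List (α × α) :=
  match _h : colTransposition U J with
  | none => []
  | some p => p :: colTower U (insert p.2 (J.erase p.1))
termination_by ∑ j ∈ J, (U.filter (j < ·)).card
decreasing_by
  obtain ⟨_, h2, h3, h4, h5⟩ := colTransposition_spec _h
  rw [Finset.sum_insert (fun h => h5 (Finset.mem_of_mem_erase h)),
    ← Finset.add_sum_erase J _ h4]
  refine Nat.add_lt_add_right (Finset.card_lt_card ?_) _
  refine Finset.ssubset_iff_subset_ne.2 ⟨fun c hc => ?_, fun he => ?_⟩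
  · simp only [Finset.mem_filter] at hc ⊢
    exact ⟨hc.1, h3.trans hc.2⟩
  · have : p.2 ∈ U.filter (p.1 < ·) := by simp [h2, h3]
    rw [← he] at this
    simp at this

variable (α) in
/-- A pair `(Z, W)` of a row and a column multiindex, not necessarily increasing, with their
complements `(Z', W')`, not necessarily increasing either. -/
structure Index where
  /-- the row multiindex `Z` -/
  row : List α
  /-- its complement `Z'` -/
  row' : List α
  /-- the column multiindex `W` -/
  col : List α
  /-- its complement `W'` -/
  col' : List α

/-- The row action of a transposition: it exchanges the values `p.1`, `p.2` in `(Z, Z')`. -/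
def Index.rowAct (p : α × α) (t : Index α) : Index α :=
  { t with row := t.row.map (Equiv.swap p.1 p.2), row' := t.row'.map (Equiv.swap p.1 p.2) }

/-- The column action of a transposition: it exchanges the values `p.1`, `p.2` in `(W, W')`. -/
def Index.colAct (p : α × α) (t : Index α) : Index α :=
  { t with col := t.col.map (Equiv.swap p.1 p.2), col' := t.col'.map (Equiv.swap p.1 p.2) }

/-- The pair `(I_0, J_0)`: the first `r` elements of `U` and the last `m` elements of `V`, with
their complements in `U` and `V`. -/
def baseIndex (U V : Finset α) (r m : ℕ) : Index α where
  row := U.sort.take r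
  row' := U.sort.drop r
  col := V.sort.drop (V.card - m)
  col' := V.sort.take (V.card - m)

/-- The lists `C_i^{I_0, J_s}`, where `σ_s, …, σ_1` is the given list of transpositions. The
members of `C_i^{I_0, J_{s-1}}` with `(W, W') = (… a … b …)`, where `σ_s = (a, b)`, `a < b`, are
those that do not pass to `C_{i+1}^{I_0, J_s}`. -/
def colC (t₀ : Index α) : List (α × α) → ℕ → List (Index α)
  | [], 0 => [t₀]
  | [], _ + 1 => []
  | p :: σ, 0 => (colC t₀ σ 0).map (Index.colAct p)
  | p :: σ, i + 1 =>
      ((colC t₀ σ i).filter fun t => ¬ [p.1, p.2].Sublist (t.col ++ t.col')) ++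
        (colC t₀ σ (i + 1)).map (Index.colAct p)

/-- The lists `C_i^{I_t, J_M}`, every member with its sign, where `σ_t, …, σ_1` is the first given
list of transpositions and `τ` the list of transpositions of the column tower. The sign is
`(-1)^i` on `C_i^{I_0, J_M}`, and is carried along by the recursion. The members of
`C_i^{I_{t-1}, J_M}` with `(Z, Z') = (… b … a …)`, where `σ_t = (a, b)`, `a < b`, are those that
do not pass to `C_{i+1}^{I_t, J_M}`. -/
def signedC (t₀ : Index α) (τ : List (α × α)) : List (α × α) → ℕ → List (ℤ × Index α)
  | [], i => (colC t₀ τ i).map fun t => ((-1) ^ i, t)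
  | p :: σ, 0 => (signedC t₀ τ σ 0).map fun y => (y.1, y.2.rowAct p)
  | p :: σ, i + 1 =>
      ((signedC t₀ τ σ i).filter fun y => ¬ [p.2, p.1].Sublist (y.2.row ++ y.2.row')) ++
        (signedC t₀ τ σ (i + 1)).map fun y => (y.1, y.2.rowAct p)

/-- The list `C_i^{I, J}` of pairs `(Z, W)` with their signs, built from the standard row tower of
`I` in `U` and the standard column tower of `J` in `V`. -/
def C (U V I J : Finset α) (i : ℕ) : List (ℤ × Index α) :=
  signedC (baseIndex U V I.card J.card) (colTower V J) (rowTower U I) i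

end Combinatorics

end QuantumMinor

/-!
The identity is proved for formal monomials `x_{z_1 w_1} ⋯ x_{z_m w_m}` with distinct rows `z_i`.
For rows `i < k` the Manin relations rewrite `x_{k l} x_{i j}` as a combination of monomials
`x_{i •} x_{k •}`, with coefficients that depend only on the columns `l`, `j`: they are those of a
braiding that satisfies a Hecke relation (`braid_braid`). Hence all computations take place in the
free module on pairs of a row word and a column word (`RowColModule`), modulo the submodule
`relations`, and the quantum matrix algebra enters only at the end, through the evaluation map
`evalMono`, which annihilates `relations` (`evalMono_eq_zero`) and sends formal products of minors
to products of minors (`evalMono_wedgePair`).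

Two kinds of symmetries act on this quotient.

* The braiding commutes with the quantum group of `𝔤𝔩` acting on column words
  (`isIntertwiner_shift`). On a product of two minors its root vectors act by a skew Leibniz rule
  (`shift_wedge`), so that for columns `a < b`, each in exactly one of the two minors, the operator
  `q F E - q⁻¹` exchanges `a` and `b` up to a multiple of the original product
  (`exists_exchange`). A column of `C`, which occurs in both minors, can be moved out of the way by
  root vectors; this is why the columns of `C` may lie anywhere between `a` and `b`.
* By the Hecke relation of the braiding, exchanging two adjacent rows, with a correction term
  according to their order in the row word, also preserves `relations`
  (`rowExchange_mem_relations`).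

These operators act on the summands by the recursion that defines the lists `C_i`
(`exchange_colTerm`, `rowExchange_single`, `sum_range_lists`). If both columns lie in the same minor,
the column operator acts by a scalar, and the change in the number of inversions of the column
sequence accounts for it. So the identity for one member of a standard tower implies the identity
for the preceding one (`mono_wedgePair_eq_sum_colC`, `mono_wedgePair_eq_sum_signedC`). What remains is the case at the
end of both towers, where all rows of `K` are larger than those of `I` and the columns of `L` not
in `J` are smaller than those of `J` not in `L`. There the two minors commute up to the factor
`q ^ z` (`mono_wedgePair`): if no column of `J` is smaller than a column of `L` outside `J`, this
is seen by moving the generators past each other, and root vectors reduce the general case to this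
one.
-/

namespace QuantumMinor

/-! ### Words of column indices -/

section Words

variable {R α : Type*} [CommRing R]

/-- Prefixing a letter, as a linear map on the free module on words. -/
noncomputable def consWord (R : Type*) [CommRing R] {α : Type*} (c : α) :
    (List α →₀ R) →ₗ[R] (List α →₀ R) :=
  Finsupp.lmapDomain R R (List.cons c)

@[simp] theorem consWord_single (c : α) (w : List α) (r : R) :
    consWord R c (Finsupp.single w r) = Finsupp.single (c :: w) r := by
  simp [consWord]

/-- The span of the words of length `m` with letters in `Q`. -/
noncomputable def wordSpan (R : Type*) [CommRing R] {α : Type*} (Q : Set α) (m : ℕ) :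
    Submodule R (List α →₀ R) :=
  Submodule.span R {v | ∃ w : List α, w.length = m ∧ (∀ c ∈ w, c ∈ Q) ∧ v = Finsupp.single w 1}

theorem single_mem_wordSpan {Q : Set α} {w : List α} (hw : ∀ c ∈ w, c ∈ Q) :
    Finsupp.single w (1 : R) ∈ wordSpan R Q w.length :=
  Submodule.subset_span ⟨w, rfl, hw, rfl⟩

theorem wordSpan_mono {Q Q' : Set α} (h : Q ⊆ Q') (m : ℕ) : wordSpan R Q m ≤ wordSpan R Q' m := by
  refine Submodule.span_mono ?_
  rintro v ⟨w, h1, h2, rfl⟩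
  exact ⟨w, h1, fun c hc => h (h2 c hc), rfl⟩

/-- To check that a linear map sends the word span into a submodule, it suffices to look at
words. -/
theorem wordSpan_le_comap {M : Type*} [AddCommMonoid M] [Module R M] {Q : Set α} {m : ℕ}
    (f : (List α →₀ R) →ₗ[R] M) (S : Submodule R M)
    (h : ∀ w : List α, w.length = m → (∀ c ∈ w, c ∈ Q) → f (Finsupp.single w 1) ∈ S)
    {v : List α →₀ R} (hv : v ∈ wordSpan R Q m) : f v ∈ S := by
  have : wordSpan R Q m ≤ S.comap f := by
    refine Submodule.span_le.2 ?_
    rintro _ ⟨w, h1, h2, rfl⟩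
    exact h w h1 h2
  exact this hv

theorem wordSpan_ext {M : Type*} [AddCommMonoid M] [Module R M] {Q : Set α} {m : ℕ}
    (f g : (List α →₀ R) →ₗ[R] M)
    (h : ∀ w : List α, w.length = m → (∀ c ∈ w, c ∈ Q) →
      f (Finsupp.single w 1) = g (Finsupp.single w 1))
    {v : List α →₀ R} (hv : v ∈ wordSpan R Q m) : f v = g v := by
  refine LinearMap.eqOn_span (f := f) (g := g) ?_ hv
  rintro _ ⟨w, h1, h2, rfl⟩
  exact h w h1 h2

theorem consWord_mem_wordSpan {Q : Set α} {m : ℕ} {c : α} (hc : c ∈ Q) {v : List α →₀ R}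
    (hv : v ∈ wordSpan R Q m) : consWord R c v ∈ wordSpan R Q (m + 1) := by
  refine wordSpan_le_comap (consWord R c) _ (fun w h1 h2 => ?_) hv
  rw [consWord_single, ← h1]
  exact single_mem_wordSpan (w := c :: w) (by simpa [hc] using h2)

/-! ### The braiding -/

variable [LinearOrder α]

/-- The braiding of the letters in positions `i`, `i + 1` of a word. -/
noncomputable def braidWord (q p : R) : ℕ → List α → (List α →₀ R)
  | 0, l :: j :: w =>
      if l < j then Finsupp.single (j :: l :: w) 1
      else if l = j then Finsupp.single (j :: l :: w) q
      else Finsupp.single (j :: l :: w) 1 - Finsupp.single (l :: j :: w) (p - q)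
  | 0, _ => 0
  | i + 1, c :: w => consWord R c (braidWord q p i w)
  | _ + 1, [] => 0

/-- The linear map `x_{k l} x_{i j} ↦ x_{i •} x_{k •}` (`i < k`) induced by the Manin relations on
the column indices in positions `i`, `i + 1`; the parameter `p` stands for `q⁻¹`. -/
noncomputable def braid (q p : R) (i : ℕ) : (List α →₀ R) →ₗ[R] (List α →₀ R) :=
  Finsupp.linearCombination R (braidWord q p i)

variable {q p : R}

theorem braid_zero_of_lt {l j : α} (h : l < j) (v : List α →₀ R) :
    braid q p 0 (consWord R l (consWord R j v)) = consWord R j (consWord R l v) := by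
  induction v using Finsupp.induction_linear with
  | zero => simp
  | add f g hf hg => simp only [map_add, hf, hg]
  | single w r => simp [braid, braidWord, h]

theorem braid_zero_self (j : α) (v : List α →₀ R) :
    braid q p 0 (consWord R j (consWord R j v)) = q • consWord R j (consWord R j v) := by
  induction v using Finsupp.induction_linear with
  | zero => simp
  | add f g hf hg => simp only [map_add, hf, hg, smul_add]
  | single w r => simp [braid, braidWord, mul_comm]

theorem braid_zero_of_gt {l j : α} (h : j < l) (v : List α →₀ R) :
    braid q p 0 (consWord R l (consWord R j v)) =
      consWord R j (consWord R l v) - (p - q) • consWord R l (consWord R j v) := by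
  induction v using Finsupp.induction_linear with
  | zero => simp
  | add f g hf hg => simp only [map_add, hf, hg, smul_add]; abel
  | single w r =>
    simp only [braid, braidWord, h.not_gt, h.ne', if_false, consWord_single,
      Finsupp.linearCombination_single, smul_sub, Finsupp.smul_single, smul_eq_mul, mul_one,
      mul_comm]

theorem braid_succ (i : ℕ) (c : α) (v : List α →₀ R) :
    braid q p (i + 1) (consWord R c v) = consWord R c (braid q p i v) := by
  induction v using Finsupp.induction_linear with
  | zero => simp
  | add f g hf hg => simp only [map_add, hf, hg]
  | single w r => simp [braid, braidWord]

theorem braid_mem_wordSpan {Q : Set α} {m : ℕ} (i : ℕ) {v : List α →₀ R}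
    (hv : v ∈ wordSpan R Q m) : braid q p i v ∈ wordSpan R Q m := by
  refine wordSpan_le_comap _ _ (fun w h1 h2 => ?_) hv
  clear hv
  induction i generalizing w m with
  | zero =>
    match w with
    | [] => simp [braid, braidWord]
    | [_] => simp [braid, braidWord]
    | l :: j :: w =>
      have hl : l ∈ Q := h2 _ (by simp)
      have hj : j ∈ Q := h2 _ (by simp)
      have hw := single_mem_wordSpan (R := R) (Q := Q) (w := w) (fun c hc => h2 c (by simp [hc]))
      have hlj := consWord_mem_wordSpan hl (consWord_mem_wordSpan hj hw)
      have hjl := consWord_mem_wordSpan hj (consWord_mem_wordSpan hl hw)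
      have e : Finsupp.single (l :: j :: w) (1 : R) =
        consWord R l (consWord R j (Finsupp.single w 1)) := by simp
      rw [← h1, e]
      rcases lt_trichotomy l j with h | rfl | h
      · rw [braid_zero_of_lt h]; exact hjl
      · rw [braid_zero_self]; exact Submodule.smul_mem _ _ hjl
      · rw [braid_zero_of_gt h]; exact Submodule.sub_mem _ hjl (Submodule.smul_mem _ _ hlj)
  | succ i ih =>
    match w with
    | [] => simp [braid, braidWord]
    | c :: w =>
      have e : Finsupp.single (c :: w) (1 : R) = consWord R c (Finsupp.single w 1) := by simp
      rw [e, braid_succ, ← h1]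
      exact consWord_mem_wordSpan (h2 c (by simp)) (ih w rfl fun c hc => h2 c (by simp [hc]))

/-- The Hecke relation of the braiding. -/
theorem braid_braid (hqp : q * p = 1) {Q : Set α} {m i : ℕ} (hi : i + 1 < m) {v : List α →₀ R}
    (hv : v ∈ wordSpan R Q m) : braid q p i (braid q p i v) = v - (p - q) • braid q p i v := by
  have := wordSpan_ext (braid q p i ∘ₗ braid q p i) (LinearMap.id - (p - q) • braid q p i)
    (fun w h1 _ => ?_) hv
  · simpa using this
  clear hv
  simp only [LinearMap.comp_apply, LinearMap.sub_apply, LinearMap.smul_apply, LinearMap.id_apply]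
  induction i generalizing w m with
  | zero =>
    match w with
    | [] => simp at h1; omega
    | [_] => simp at h1; omega
    | l :: j :: w =>
      have e : Finsupp.single (l :: j :: w) (1 : R) =
        consWord R l (consWord R j (Finsupp.single w 1)) := by simp
      rw [e]
      rcases lt_trichotomy l j with h | rfl | h
      · simp only [braid_zero_of_lt h, braid_zero_of_gt h]
      · simp only [braid_zero_self, map_smul]
        match_scalars
        linear_combination hqp
      · simp only [braid_zero_of_lt h, braid_zero_of_gt h, map_smul, map_sub]
  | succ i ih =>
    match w with
    | [] => simp at h1; omega
    | c :: w =>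
      have e : Finsupp.single (c :: w) (1 : R) = consWord R c (Finsupp.single w 1) := by simp
      simp only [e, braid_succ]
      rw [ih (m := w.length) (by simp at h1; omega) w rfl ?_]
      · simp only [map_sub, map_smul]
      · intro d hd
        rename_i h2
        exact h2 d (by simp [hd])

/-! ### Column operators -/

/-- The weight of a letter under the `q`-analogue of the coroot of the pair `a < b`. -/
def weight (q p : R) (a b c : α) : R := if c = a then p else if c = b then q else 1

/-- The action on words of the root vector that replaces one letter `s` by `t`, where
`{s, t} = {a, b}`; see `shift`. -/
noncomputable def shiftWord (q p : R) (a b s t : α) : List α → (List α →₀ R)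
  | [] => 0
  | c :: w => (if c = s then Finsupp.single (t :: w) 1 else 0) +
      weight q p a b c • consWord R c (shiftWord q p a b s t w)

/-- The root vector of the quantum group of `𝔤𝔩` that belongs to the adjacent letters `a < b`: it
replaces one occurrence of `s` by `t`, and picks up the weights of the letters standing before it.
For `(s, t) = (b, a)` and `(s, t) = (a, b)` this is the raising and the lowering operator. -/
noncomputable def shift (q p : R) (a b s t : α) : (List α →₀ R) →ₗ[R] (List α →₀ R) :=
  Finsupp.linearCombination R (shiftWord q p a b s t)

@[simp] theorem shift_nil (a b s t : α) (r : R) : shift q p a b s t (Finsupp.single [] r) = 0 := by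
  simp [shift, shiftWord]

theorem shift_cons (a b s t c : α) (v : List α →₀ R) :
    shift q p a b s t (consWord R c v) = (if c = s then consWord R t v else 0) +
      weight q p a b c • consWord R c (shift q p a b s t v) := by
  induction v using Finsupp.induction_linear with
  | zero => simp
  | add f g hf hg =>
    simp only [map_add, hf, hg, smul_add]
    split_ifs
    · abel
    · simp
  | single w r =>
    simp only [shift, consWord_single, Finsupp.linearCombination_single, shiftWord, smul_add,
      map_smul]
    rw [smul_comm]
    split_ifs <;> simp

/-- A linear map on words that commutes with the braiding of words with letters in `Q`. -/
def IsIntertwiner (q p : R) (Q : Set α) (f : (List α →₀ R) →ₗ[R] (List α →₀ R)) : Prop :=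
  ∀ (m : ℕ), ∀ v ∈ wordSpan R Q m,
    f v ∈ wordSpan R Q m ∧ ∀ i, f (braid q p i v) = braid q p i (f v)

theorem IsIntertwiner.comp {Q : Set α} {f g : (List α →₀ R) →ₗ[R] (List α →₀ R)}
    (hf : IsIntertwiner q p Q f) (hg : IsIntertwiner q p Q g) : IsIntertwiner q p Q (f ∘ₗ g) :=
  fun m v hv => ⟨(hf m _ (hg m v hv).1).1, fun i => by
    rw [LinearMap.comp_apply, LinearMap.comp_apply, (hg m v hv).2, (hf m _ (hg m v hv).1).2]⟩

theorem IsIntertwiner.smul_sub_smul {Q : Set α} {f g : (List α →₀ R) →ₗ[R] (List α →₀ R)}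
    (hf : IsIntertwiner q p Q f) (hg : IsIntertwiner q p Q g) (r s : R) :
    IsIntertwiner q p Q (r • f - s • g) :=
  fun m v hv => ⟨Submodule.sub_mem _ (Submodule.smul_mem _ _ (hf m v hv).1)
    (Submodule.smul_mem _ _ (hg m v hv).1), fun i => by
    simp only [LinearMap.sub_apply, LinearMap.smul_apply, map_sub, map_smul, (hf m v hv).2,
      (hg m v hv).2]⟩

theorem isIntertwiner_id (Q : Set α) :
    IsIntertwiner q p Q (LinearMap.id : (List α →₀ R) →ₗ[R] (List α →₀ R)) :=
  fun _ _ hv => ⟨hv, fun _ => rfl⟩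

theorem shift_mem_wordSpan {Q : Set α} {m : ℕ} {a b s t : α} (ht : t ∈ Q) {v : List α →₀ R}
    (hv : v ∈ wordSpan R Q m) : shift q p a b s t v ∈ wordSpan R Q m := by
  refine wordSpan_le_comap _ _ (fun w h1 h2 => ?_) hv
  clear hv
  subst h1
  induction w with
  | nil => simp
  | cons c w ih =>
    have e : Finsupp.single (c :: w) (1 : R) = consWord R c (Finsupp.single w 1) := by simp
    have hw : ∀ d ∈ w, d ∈ Q := fun d hd => h2 d (by simp [hd])
    rw [e, shift_cons]
    refine Submodule.add_mem _ ?_ (Submodule.smul_mem _ _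
      (consWord_mem_wordSpan (h2 c (by simp)) (ih hw)))
    split_ifs
    · exact consWord_mem_wordSpan ht (single_mem_wordSpan hw)
    · exact Submodule.zero_mem _

theorem shift_braid_zero (hqp : q * p = 1) {a b s t l j : α} (hab : a < b)
    (hst : s = a ∧ t = b ∨ s = b ∧ t = a)
    (hl : l ≤ a ∨ b ≤ l) (hj : j ≤ a ∨ b ≤ j) (v : List α →₀ R) :
    shift q p a b s t (braid q p 0 (consWord R l (consWord R j v))) =
      braid q p 0 (shift q p a b s t (consWord R l (consWord R j v))) := by
  have key : ∀ c, (c ≤ a ∨ b ≤ c) → (c = a ∨ c = b) ∨ ((c < a ∧ c < b) ∨ (a < c ∧ b < c)) := by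
    rintro c (h | h)
    · rcases h.eq_or_lt with h | h
      · exact .inl (.inl h)
      · exact .inr (.inl ⟨h, h.trans hab⟩)
    · rcases h.eq_or_lt with h | h
      · exact .inl (.inr h.symm)
      · exact .inr (.inr ⟨hab.trans h, h⟩)
  have outer : ∀ c, (c < a ∧ c < b) ∨ (a < c ∧ b < c) →
      c ≠ a ∧ c ≠ b ∧ c ≠ s ∧ weight q p a b c = 1 ∧ ((c < s ↔ c < t) ∧ (s < c ↔ t < c)) := by
    rintro c h
    have h1 : c ≠ a := by rintro rfl; simp [hab.not_gt] at h
    have h2 : c ≠ b := by rintro rfl; simp [hab.not_gt] at h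
    refine ⟨h1, h2, ?_, by simp [weight, h1, h2], ?_⟩
    · rcases hst with ⟨rfl, rfl⟩ | ⟨rfl, rfl⟩ <;> assumption
    · rcases hst with ⟨rfl, rfl⟩ | ⟨rfl, rfl⟩ <;> rcases h with ⟨h, h'⟩ | ⟨h, h'⟩ <;>
        simp [h, h', h.not_gt, h'.not_gt]
  have wa : weight q p a b a = p := by simp [weight]
  have wb : weight q p a b b = q := by simp [weight, hab.ne']
  -- one of the letters is neither `a` nor `b`
  have mixed : ∀ c d, (c < a ∧ c < b) ∨ (a < c ∧ b < c) → (d = s ∨ d = t) →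
      shift q p a b s t (braid q p 0 (consWord R c (consWord R d v))) =
        braid q p 0 (shift q p a b s t (consWord R c (consWord R d v))) ∧
      shift q p a b s t (braid q p 0 (consWord R d (consWord R c v))) =
        braid q p 0 (shift q p a b s t (consWord R d (consWord R c v))) := by
    intro c d hc hd
    obtain ⟨-, -, h3, h4, h5, h6⟩ := outer c hc
    have hts : t ≠ s := by rcases hst with ⟨rfl, rfl⟩ | ⟨rfl, rfl⟩ <;> simp [hab.ne, hab.ne']
    rcases hd with rfl | rfl <;> rcases lt_or_gt_of_ne h3 with h | h
    · simp only [braid_zero_of_lt h, braid_zero_of_gt h, braid_zero_of_lt (h5.1 h),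
        braid_zero_of_gt (h5.1 h), shift_cons, h3, h4, if_false, if_true, map_add, map_sub,
        map_smul, zero_add, one_smul]
      exact ⟨trivial, by module⟩
    · simp only [braid_zero_of_lt h, braid_zero_of_gt h, braid_zero_of_lt (h6.1 h),
        braid_zero_of_gt (h6.1 h), shift_cons, h3, h4, if_false, if_true, map_add, map_sub,
        map_smul, zero_add, one_smul]
      exact ⟨by module, trivial⟩
    · simp only [braid_zero_of_lt (h5.1 h),
        braid_zero_of_gt (h5.1 h), shift_cons, h3, h4, hts, if_false, map_sub,
        map_smul, zero_add, one_smul]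
      exact ⟨trivial, by module⟩
    · simp only [braid_zero_of_lt (h6.1 h),
        braid_zero_of_gt (h6.1 h), shift_cons, h3, h4, hts, if_false, map_sub,
        map_smul, zero_add, one_smul]
      exact ⟨by module, trivial⟩
  have hab' : ∀ c, c = a ∨ c = b → c = s ∨ c = t := by
    rcases hst with ⟨rfl, rfl⟩ | ⟨rfl, rfl⟩ <;> simp [or_comm]
  have both : ∀ c d, (c = a ∨ c = b) → (d = a ∨ d = b) →
      shift q p a b s t (braid q p 0 (consWord R c (consWord R d v))) =
        braid q p 0 (shift q p a b s t (consWord R c (consWord R d v))) := by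
    rintro c d (rfl | rfl) (rfl | rfl) <;> rcases hst with ⟨rfl, rfl⟩ | ⟨rfl, rfl⟩ <;>
      simp only [braid_zero_of_lt hab, braid_zero_of_gt hab, braid_zero_self, shift_cons, wa, wb,
        hab.ne, hab.ne', if_true, if_false, map_add, map_sub, map_smul, zero_add] <;>
      match_scalars <;> first | ring1 | linear_combination hqp | linear_combination -hqp
  rcases key l hl with h | h <;> rcases key j hj with h' | h'
  · exact both _ _ h h'
  · exact (mixed _ _ h' (hab' _ h)).2
  · exact (mixed _ _ h (hab' _ h')).1
  obtain ⟨-, -, h3, h4, -⟩ := outer l h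
  obtain ⟨-, -, h3', h4', -⟩ := outer j h'
  rcases lt_trichotomy l j with hlj | rfl | hlj
  · simp only [braid_zero_of_lt hlj, shift_cons, h3, h4, h3', h4', if_false, zero_add, one_smul]
  · simp only [braid_zero_self, shift_cons, h3, h4, if_false, zero_add, one_smul, map_smul]
  · simp only [braid_zero_of_gt hlj, shift_cons, h3, h4, h3', h4', if_false, zero_add, one_smul,
      map_sub, map_smul]

/-- The root vectors of adjacent letters commute with the braiding. -/
theorem isIntertwiner_shift (hqp : q * p = 1) {Q : Set α} {a b s t : α} (hab : a < b)
    (hst : s = a ∧ t = b ∨ s = b ∧ t = a) (ht : t ∈ Q) (hQ : ∀ c ∈ Q, c ≤ a ∨ b ≤ c) :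
    IsIntertwiner q p Q (shift q p a b s t) := by
  intro m v hv
  refine ⟨shift_mem_wordSpan ht hv, fun i => ?_⟩
  refine wordSpan_ext (shift q p a b s t ∘ₗ braid q p i) (braid q p i ∘ₗ shift q p a b s t)
    (fun w h1 h2 => ?_) hv
  clear hv h1
  simp only [LinearMap.comp_apply]
  induction i generalizing w with
  | zero =>
    match w with
    | [] => simp [braid, braidWord]
    | [c] =>
      have e : Finsupp.single [c] (1 : R) = consWord R c (Finsupp.single [] 1) := by simp
      have z : ∀ d : α, braid q p 0 (Finsupp.single [d] (1 : R)) = 0 := by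
        simp [braid, braidWord]
      rw [z, e, shift_cons]
      split_ifs <;> simp [z]
    | l :: j :: w =>
      have e : Finsupp.single (l :: j :: w) (1 : R) =
        consWord R l (consWord R j (Finsupp.single w 1)) := by simp
      rw [e]
      exact shift_braid_zero hqp hab hst (hQ l (h2 l (by simp))) (hQ j (h2 j (by simp))) _
  | succ i ih =>
    match w with
    | [] => simp [braid, braidWord]
    | c :: w =>
      have e : Finsupp.single (c :: w) (1 : R) = consWord R c (Finsupp.single w 1) := by simp
      rw [e, braid_succ, shift_cons, shift_cons, ih w fun d hd => h2 d (by simp [hd])]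
      split_ifs <;> simp [braid_succ, -consWord_single]

end Words

/-! ### Quantum exterior products -/

section Wedge

variable {R α : Type*} [CommRing R] [LinearOrder α]

/-- Left multiplication by the `q`-antisymmetrised product `∑_w (-q)^{-l(w)} w_1 ⋯ w_m` of the
elements of a set `X` with `m` elements, by recursion on the first letter; `p` stands for
`q⁻¹`. -/
noncomputable def wedge (p : R) : ℕ → Finset α → (List α →₀ R) →ₗ[R] (List α →₀ R)
  | 0, _ => LinearMap.id
  | m + 1, X => ∑ c ∈ X, (-p) ^ (X.filter (· < c)).card • (consWord R c ∘ₗ wedge p m (X.erase c))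

variable {q p : R}

@[simp] theorem wedge_zero (X : Finset α) (v : List α →₀ R) : wedge p 0 X v = v := rfl

theorem wedge_succ (m : ℕ) (X : Finset α) (v : List α →₀ R) :
    wedge p (m + 1) X v =
      ∑ c ∈ X, (-p) ^ (X.filter (· < c)).card • consWord R c (wedge p m (X.erase c) v) := by
  simp [wedge]

theorem wedge_mem_wordSpan {Q : Set α} {m r : ℕ} {X : Finset α} (hX : ∀ c ∈ X, c ∈ Q)
    {v : List α →₀ R} (hv : v ∈ wordSpan R Q r) : wedge p m X v ∈ wordSpan R Q (r + m) := by
  induction m generalizing X with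
  | zero => simpa
  | succ m ih =>
    rw [wedge_succ, ← add_assoc]
    exact Submodule.sum_mem _ fun c hc => Submodule.smul_mem _ _
      (consWord_mem_wordSpan (hX c hc) (ih fun d hd => hX d (Finset.mem_of_mem_erase hd)))

/-- The weight of a set of letters. -/
noncomputable def setWeight (q p : R) (a b : α) (X : Finset α) : R := ∏ c ∈ X, weight q p a b c

theorem setWeight_eq (hqp : q * p = 1) {a b : α} (hab : a ≠ b) (X : Finset α) :
    setWeight q p a b X =
      if a ∈ X then (if b ∈ X then 1 else p) else (if b ∈ X then q else 1) := by
  have h0 : ∀ Y : Finset α, a ∉ Y → b ∉ Y → setWeight q p a b Y = 1 := by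
    intro Y ha hb
    refine Finset.prod_eq_one fun c hc => ?_
    have h1 : c ≠ a := by rintro rfl; exact ha hc
    have h2 : c ≠ b := by rintro rfl; exact hb hc
    simp [weight, h1, h2]
  have h1 : ∀ Y : Finset α, a ∉ Y → setWeight q p a b Y = if b ∈ Y then q else 1 := by
    intro Y ha
    split_ifs with hb
    · rw [setWeight, ← Finset.mul_prod_erase _ _ hb]
      have := h0 (Y.erase b) (by simp [ha]) (by simp)
      rw [setWeight] at this
      rw [this]
      simp [weight, hab.symm]
    · exact h0 Y ha hb
  by_cases ha : a ∈ X
  · have := h1 (X.erase a) (by simp)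
    rw [setWeight] at this
    rw [setWeight, ← Finset.mul_prod_erase _ _ ha, this, if_pos ha]
    have hab' := hab.symm
    by_cases hb : b ∈ X
    · simp only [Finset.mem_erase, hb, hab', ne_eq, not_false_eq_true, and_self, if_true, weight]
      rw [mul_comm, hqp]
    · simp [hb, weight]
  · rw [if_neg ha, h1 X ha]

/-- Exchange of two letters in a set. -/
abbrev swapSet (a b : α) (X : Finset α) : Finset α := X.map (Equiv.swap a b).toEmbedding

theorem swapSet_eq_self {a b : α} {X : Finset α} (h : a ∈ X ↔ b ∈ X) : swapSet a b X = X := by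
  ext c
  simp only [Finset.mem_map_equiv, Equiv.symm_swap]
  rcases eq_or_ne c a with rfl | h1
  · simp [h]
  rcases eq_or_ne c b with rfl | h2
  · simp [h]
  rw [Equiv.swap_apply_of_ne_of_ne h1 h2]

theorem swapSet_comm (a b : α) (X : Finset α) : swapSet a b X = swapSet b a X := by
  rw [swapSet, swapSet, Equiv.swap_comm]

theorem mem_swapSet {a b c : α} {X : Finset α} : c ∈ swapSet a b X ↔ Equiv.swap a b c ∈ X := by
  simp [Finset.mem_map_equiv]

@[simp] theorem left_mem_swapSet {a b : α} {X : Finset α} : a ∈ swapSet a b X ↔ b ∈ X := by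
  simp

@[simp] theorem right_mem_swapSet {a b : α} {X : Finset α} : b ∈ swapSet a b X ↔ a ∈ X := by
  simp

theorem mem_swapSet_of_ne {a b c : α} (ha : c ≠ a) (hb : c ≠ b) {X : Finset α} :
    c ∈ swapSet a b X ↔ c ∈ X := by
  simp [Equiv.swap_apply_of_ne_of_ne ha hb]

theorem swapSet_swapSet (a b : α) (X : Finset α) : swapSet a b (swapSet a b X) = X := by
  ext c
  simp

theorem swapSet_conj {a b c : α} (hab : a ≠ b) (hac : a ≠ c) (hbc : b ≠ c) (X : Finset α) :
    swapSet c b (swapSet a c (swapSet c b X)) = swapSet a b X := by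
  ext d
  rw [mem_swapSet, mem_swapSet, mem_swapSet, mem_swapSet]
  have : Equiv.swap c b (Equiv.swap a c (Equiv.swap c b d)) = Equiv.swap a b d := by
    simp only [Equiv.swap_apply_def]
    split_ifs <;> grind
  rw [this]

theorem swapSet_subset {a b : α} {X Q : Finset α} (ha : a ∈ Q) (hb : b ∈ Q) (hX : X ⊆ Q) :
    swapSet a b X ⊆ Q := by
  intro c hc
  by_cases h1 : c = a
  · exact h1 ▸ ha
  by_cases h2 : c = b
  · exact h2 ▸ hb
  exact hX ((mem_swapSet_of_ne h1 h2).1 hc)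

theorem card_swapSet (a b : α) (X : Finset α) : (swapSet a b X).card = X.card := by simp

/-- Exchanging the adjacent letters `a`, `b` does not change the order relations with other
letters. -/
theorem swap_lt_swap_iff {a b c d : α} (hab : a < b) (hc : c ≤ a ∨ b ≤ c) (hd : d ≤ a ∨ b ≤ d)
    (h1 : ¬ (c = a ∧ d = b)) (h2 : ¬ (c = b ∧ d = a)) :
    Equiv.swap a b c < Equiv.swap a b d ↔ c < d := by
  simp only [Equiv.swap_apply_def]
  split_ifs <;> grind

/-- The action of a root vector on a quantum exterior product: it is a skew derivation that
annihilates the exterior product of a set containing `t` or not containing `s`, and replaces `s`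
by `t` in the remaining case. -/
theorem shift_wedge (hqp : q * p = 1) {a b s t : α} (hab : a < b)
    (hst : s = a ∧ t = b ∨ s = b ∧ t = a) {X : Finset α} (hX : ∀ c ∈ X, c ≤ a ∨ b ≤ c)
    {m : ℕ} (hm : X.card = m) (v : List α →₀ R) :
    shift q p a b s t (wedge p m X v) =
      (if s ∈ X ∧ t ∉ X then wedge p m (swapSet a b X) v else 0) +
        setWeight q p a b X • wedge p m X (shift q p a b s t v) := by
  induction m generalizing X with
  | zero =>
    obtain rfl := Finset.card_eq_zero.1 hm
    simp [setWeight]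
  | succ m ih =>
    have hts : t ≠ s := by rcases hst with ⟨rfl, rfl⟩ | ⟨rfl, rfl⟩ <;> simp [hab.ne, hab.ne']
    have hsw : Equiv.swap a b s = t := by
      rcases hst with ⟨rfl, rfl⟩ | ⟨rfl, rfl⟩ <;> simp
    have hsw' : Equiv.swap a b t = s := by
      rcases hst with ⟨rfl, rfl⟩ | ⟨rfl, rfl⟩ <;> simp
    have hne : ∀ c, c ≠ s → c ≠ t → c ≠ a ∧ c ≠ b := by
      rcases hst with ⟨rfl, rfl⟩ | ⟨rfl, rfl⟩ <;> tauto
    have hw1 : ∀ c, c ≠ s → c ≠ t → weight q p a b c = 1 := fun c h1 h2 => by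
      simp [weight, (hne c h1 h2).1, (hne c h1 h2).2]
    have hab' : ∀ Y : Finset α, (a ∈ Y ↔ b ∈ Y) ↔ (s ∈ Y ↔ t ∈ Y) := by
      intro Y
      rcases hst with ⟨rfl, rfl⟩ | ⟨rfl, rfl⟩ <;> tauto
    have step : shift q p a b s t (wedge p (m + 1) X v) =
        (∑ c ∈ X, (-p) ^ (X.filter (· < c)).card •
          ((if c = s then consWord R t (wedge p m (X.erase c) v) else 0) +
          (if s ∈ X.erase c ∧ t ∉ X.erase c then
            weight q p a b c • consWord R c (wedge p m (swapSet a b (X.erase c)) v) else 0))) +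
        setWeight q p a b X • wedge p (m + 1) X (shift q p a b s t v) := by
      rw [wedge_succ, wedge_succ, map_sum, Finset.smul_sum, ← Finset.sum_add_distrib]
      refine Finset.sum_congr rfl fun c hc => ?_
      rw [map_smul, shift_cons, ih (fun d hd => hX d (Finset.mem_of_mem_erase hd))
        (by rw [Finset.card_erase_of_mem hc, hm]; rfl)]
      rw [setWeight, setWeight, ← Finset.mul_prod_erase _ _ hc]
      split_ifs <;> simp only [map_add, map_smul, map_zero] <;> module
    rw [step]
    congr 1
    by_cases hs : s ∈ X
    · by_cases ht : t ∈ X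
      · -- the words with `s` before `t` cancel against those with `t` before `s`
        rw [if_neg (by simp [ht]), ← Finset.add_sum_erase _ _ hs,
          ← Finset.add_sum_erase _ _ (Finset.mem_erase.2 ⟨hts, ht⟩), Finset.sum_eq_zero, add_zero]
        · have e1 : swapSet a b (X.erase t) = X.erase s := by
            ext c
            rw [mem_swapSet]
            by_cases h1 : c = s
            · simp [h1, hsw]
            by_cases h2 : c = t
            · simp [h2, hsw', hs, hts, ht, hts.symm]
            rw [Equiv.swap_apply_of_ne_of_ne (hne c h1 h2).1 (hne c h1 h2).2]
            simp [h1, h2]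
          have e2 : (s ∈ X.erase t ∧ t ∉ X.erase t) := by simp [hs, hts.symm]
          have e3 : ¬ (s ∈ X.erase s ∧ t ∉ X.erase s) := by simp
          rw [if_pos rfl, if_neg e3, if_neg hts, if_pos e2, e1, add_zero, zero_add, smul_smul,
            ← add_smul]
          suffices H : (-p) ^ (X.filter (· < s)).card +
              (-p) ^ (X.filter (· < t)).card * weight q p a b t = 0 by rw [H, zero_smul]
          have ha : a ∈ X := by rcases hst with ⟨rfl, rfl⟩ | ⟨rfl, rfl⟩ <;> assumption
          have hcard : (X.filter (· < b)).card = (X.filter (· < a)).card + 1 := by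
            have : X.filter (· < b) = insert a (X.filter (· < a)) := by
              ext c
              simp only [Finset.mem_filter, Finset.mem_insert]
              constructor
              · rintro ⟨h1, h2⟩
                rcases hX c h1 with h | h
                · exact h.eq_or_lt.imp id fun h => ⟨h1, h⟩
                · exact absurd h2 h.not_gt
              · rintro (rfl | ⟨h1, h2⟩)
                · exact ⟨ha, hab⟩
                · exact ⟨h1, h2.trans hab⟩
            rw [this, Finset.card_insert_of_notMem (by simp)]
          rcases hst with ⟨rfl, rfl⟩ | ⟨rfl, rfl⟩
          · simp only [weight, hab.ne', if_false, if_true]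
            rw [hcard, pow_succ]
            linear_combination -(-p) ^ (X.filter (· < s)).card * hqp
          · simp only [weight, if_true]
            rw [hcard, pow_succ]
            ring
        · intro c hc
          have h1 : c ≠ t := Finset.ne_of_mem_erase hc
          have h2 : c ≠ s := Finset.ne_of_mem_erase (Finset.mem_of_mem_erase hc)
          rw [if_neg h2, if_neg (by simp [h1.symm, ht]), add_zero, smul_zero]
      · -- no cancellation: the words correspond one to one
        rw [if_pos ⟨hs, ht⟩, wedge_succ, Finset.sum_map]
        refine Finset.sum_congr rfl fun c hc => ?_
        have hct : c ≠ t := by rintro rfl; exact ht hc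
        have hcount : ((swapSet a b X).filter
            (· < (Equiv.swap a b).toEmbedding c)).card = (X.filter (· < c)).card := by
          rw [Finset.filter_map, Finset.card_map]
          congr 1
          refine Finset.filter_congr fun d hd => ?_
          have hdt : d ≠ t := by rintro rfl; exact ht hd
          refine swap_lt_swap_iff hab (hX d hd) (hX c hc) ?_ ?_ <;>
            rcases hst with ⟨rfl, rfl⟩ | ⟨rfl, rfl⟩ <;> tauto
        rw [hcount]
        have herase : (swapSet a b X).erase ((Equiv.swap a b).toEmbedding c) =
            swapSet a b (X.erase c) := (Finset.map_erase _ _ _).symm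
        rw [herase]
        congr 1
        by_cases hcs : c = s
        · subst hcs
          have e : swapSet a b (X.erase c) = X.erase c :=
            swapSet_eq_self ((hab' _).2 (by simp [ht]))
          rw [if_pos rfl, if_neg (by simp), add_zero, e]
          simp [hsw]
        · rw [if_neg hcs, if_pos (by simp [hs, ht, Ne.symm hcs]), hw1 c hcs hct, one_smul, zero_add,
            Equiv.coe_toEmbedding,
            Equiv.swap_apply_of_ne_of_ne (hne c hcs hct).1 (hne c hcs hct).2]
    · rw [if_neg (by simp [hs])]
      refine Finset.sum_eq_zero fun c hc => ?_
      have hcs : c ≠ s := by rintro rfl; exact hs hc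
      simp [hcs, hs]

/-! ### Exchanging columns in a pair of exterior products -/

/-- The element of the free module on words that belongs to the product of two minors with column
sets `X`, `Y`. -/
noncomputable def wedgePair (p : R) (X Y : Finset α) : List α →₀ R :=
  wedge p X.card X (wedge p Y.card Y (Finsupp.single [] 1))

theorem shift_wedgePair (hqp : q * p = 1) {a b s t : α} (hab : a < b)
    (hst : s = a ∧ t = b ∨ s = b ∧ t = a) {X Y : Finset α} (hX : ∀ c ∈ X, c ≤ a ∨ b ≤ c)
    (hY : ∀ c ∈ Y, c ≤ a ∨ b ≤ c) :
    shift q p a b s t (wedgePair p X Y) =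
      (if s ∈ X ∧ t ∉ X then wedgePair p (swapSet a b X) Y else 0) +
        setWeight q p a b X •
          (if s ∈ Y ∧ t ∉ Y then wedgePair p X (swapSet a b Y) else 0) := by
  rw [wedgePair, shift_wedge hqp hab hst hX rfl, shift_wedge hqp hab hst hY rfl, shift_nil]
  simp only [wedgePair, card_swapSet, map_zero, smul_zero, add_zero]
  split_ifs <;> simp

/-- If `s` lies in both sets and `t` in exactly one, the root vector exchanges `s` and `t`. -/
theorem shift_wedgePair_of_mem (hqp : q * p = 1) {a b s t : α} (hab : a < b)
    (hst : s = a ∧ t = b ∨ s = b ∧ t = a) {X Y : Finset α} (hX : ∀ c ∈ X, c ≤ a ∨ b ≤ c)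
    (hY : ∀ c ∈ Y, c ≤ a ∨ b ≤ c) (hsX : s ∈ X) (hsY : s ∈ Y) (ht : ¬ (t ∈ X ↔ t ∈ Y)) :
    shift q p a b s t (wedgePair p X Y) = wedgePair p (swapSet a b X) (swapSet a b Y) := by
  rw [shift_wedgePair hqp hab hst hX hY, setWeight_eq hqp hab.ne]
  have hmem : ∀ Z : Finset α, s ∈ Z → t ∈ Z → a ∈ Z ∧ b ∈ Z := by
    rcases hst with ⟨rfl, rfl⟩ | ⟨rfl, rfl⟩ <;> tauto
  by_cases h : t ∈ X
  · have h' : t ∉ Y := by tauto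
    have hX' := hmem X hsX h
    rw [swapSet_eq_self (X := X) (iff_of_true hX'.1 hX'.2)]
    simp only [hX'.1, hX'.2, h, h', hsY, not_true_eq_false, and_false, not_false_eq_true, and_self,
      if_true, if_false, one_smul, zero_add]
  · have h' : t ∈ Y := by tauto
    have hY' := hmem Y hsY h'
    rw [swapSet_eq_self (X := Y) (iff_of_true hY'.1 hY'.2)]
    simp only [h, h', hsX, not_true_eq_false, and_false, not_false_eq_true, and_self,
      if_true, if_false, smul_zero, add_zero]

/-- The effect on `wedgePair p X Y` of the column exchange operator of a pair `a < b` of columns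
that both lie in exactly one of the sets `X`, `Y`. -/
noncomputable def exchangePair (q p : R) (a b : α) (X Y : Finset α) : List α →₀ R :=
  if (a ∈ X ↔ b ∈ X) then -p • wedgePair p X Y
  else wedgePair p (swapSet a b X) (swapSet a b Y) -
    if a ∈ X then 0 else (p - q) • wedgePair p X Y

/-- For any two columns `a < b` there is an operator that commutes with the braiding and
exchanges `a` and `b` in all pairs of exterior products in which the columns between `a` and `b`
occur twice. For adjacent columns this is the action `q F E - q⁻¹` of a Hecke algebra generator; in
general it is conjugated by the root vectors that move the columns between `a` and `b` out of the
way. -/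
theorem exists_exchange (hqp : q * p = 1) (Q : Finset α) {a b : α} (hab : a < b) (haQ : a ∈ Q)
    (hbQ : b ∈ Q) :
    ∃ f : (List α →₀ R) →ₗ[R] (List α →₀ R), IsIntertwiner q p (Q : Set α) f ∧
      ∀ X Y : Finset α, X ⊆ Q → Y ⊆ Q → (∀ c ∈ Q, a < c → c < b → c ∈ X ∧ c ∈ Y) →
        ¬ (a ∈ X ↔ a ∈ Y) → ¬ (b ∈ X ↔ b ∈ Y) →
        f (wedgePair p X Y) = exchangePair q p a b X Y := by
  induction hn : (Q.filter fun c => a < c ∧ c < b).card generalizing b with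
  | zero =>
    have hadj : ∀ c ∈ Q, c ≤ a ∨ b ≤ c := by
      intro c hc
      rw [Finset.card_eq_zero, Finset.filter_eq_empty_iff] at hn
      have := hn hc
      by_contra! h
      exact this h
    refine ⟨q • (shift q p a b a b ∘ₗ shift q p a b b a) - p • LinearMap.id,
      ((isIntertwiner_shift hqp hab (.inl ⟨rfl, rfl⟩) hbQ hadj).comp
        (isIntertwiner_shift hqp hab (.inr ⟨rfl, rfl⟩) haQ hadj)).smul_sub_smul
        (isIntertwiner_id _) q p, ?_⟩
    intro X Y hXQ hYQ _ ha hb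
    have hX : ∀ c ∈ X, c ≤ a ∨ b ≤ c := fun c hc => hadj c (hXQ hc)
    have hY : ∀ c ∈ Y, c ≤ a ∨ b ≤ c := fun c hc => hadj c (hYQ hc)
    have hX' : ∀ c ∈ swapSet a b X, c ≤ a ∨ b ≤ c :=
      fun c hc => hadj c (swapSet_subset haQ hbQ hXQ hc)
    have hY' : ∀ c ∈ swapSet a b Y, c ≤ a ∨ b ≤ c :=
      fun c hc => hadj c (swapSet_subset haQ hbQ hYQ hc)
    simp only [LinearMap.sub_apply, LinearMap.smul_apply, LinearMap.comp_apply,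
      LinearMap.id_apply, exchangePair]
    rw [shift_wedgePair hqp hab (.inr ⟨rfl, rfl⟩) hX hY, setWeight_eq hqp hab.ne, map_add, map_smul]
    by_cases h1 : a ∈ X <;> by_cases h2 : b ∈ X
    · have h4 : b ∉ Y := by tauto
      simp [h1, h2, h4]
    · have h3 : a ∉ Y := by tauto
      have h4 : b ∈ Y := by tauto
      simp only [h1, h2, h3, h4, false_and, true_and, not_false_eq_true, if_true, if_false,
        iff_false, not_true_eq_false, map_zero, zero_add, sub_zero]
      rw [shift_wedgePair hqp hab (.inl ⟨rfl, rfl⟩) hX hY', setWeight_eq hqp hab.ne,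
        swapSet_swapSet]
      simp only [h1, h2, h3, h4, left_mem_swapSet, right_mem_swapSet, and_self, not_false_eq_true,
        if_true, if_false]
      match_scalars
      · linear_combination hqp
      · linear_combination p * hqp
    · have h3 : a ∈ Y := by tauto
      have h4 : b ∉ Y := by tauto
      simp only [h1, h2, h4, false_and, true_and, not_false_eq_true, if_true, if_false,
        iff_true, map_zero, smul_zero, add_zero]
      rw [shift_wedgePair hqp hab (.inl ⟨rfl, rfl⟩) hX' hY, setWeight_eq hqp hab.ne,
        swapSet_swapSet]
      simp only [h1, h2, h3, h4, left_mem_swapSet, right_mem_swapSet, and_self, not_false_eq_true,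
        if_true, if_false]
      match_scalars
      · ring
      · linear_combination hqp
    · have h3 : a ∈ Y := by tauto
      simp [h1, h2, h3]
  | succ m ih =>
    have hne : (Q.filter fun c => a < c ∧ c < b).Nonempty := by
      rw [← Finset.card_pos, hn]
      exact Nat.succ_pos m
    -- the last of the columns between `a` and `b`
    obtain ⟨c, hc, hmax⟩ := Finset.exists_max_image _ id hne
    obtain ⟨hcQ, hac, hcb⟩ : c ∈ Q ∧ a < c ∧ c < b := by simpa using hc
    have hadj : ∀ d ∈ Q, d ≤ c ∨ b ≤ d := by
      intro d hd
      by_contra! h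
      exact (hmax d (by simp [hd, hac.trans h.1, h.2])).not_gt h.1
    have hcard : (Q.filter fun d => a < d ∧ d < c).card = m := by
      have : (Q.filter fun d => a < d ∧ d < c) = (Q.filter fun d => a < d ∧ d < b).erase c := by
        ext d
        simp only [Finset.mem_filter, Finset.mem_erase]
        constructor
        · rintro ⟨h1, h2, h3⟩
          exact ⟨h3.ne, h1, h2, h3.trans hcb⟩
        · rintro ⟨h1, h2, h3, h4⟩
          exact ⟨h2, h3, ((hadj d h2).resolve_right h4.not_ge).lt_of_ne h1⟩
      rw [this, Finset.card_erase_of_mem hc, hn]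
      rfl
    obtain ⟨f, hf, hfw⟩ := ih hac hcQ hcard
    refine ⟨shift q p c b b c ∘ₗ f ∘ₗ shift q p c b c b,
      (isIntertwiner_shift hqp hcb (.inr ⟨rfl, rfl⟩) hcQ hadj).comp
        (hf.comp (isIntertwiner_shift hqp hcb (.inl ⟨rfl, rfl⟩) hbQ hadj)), ?_⟩
    intro X Y hXQ hYQ hbetween ha hb
    obtain ⟨hcX, hcY⟩ := hbetween c hcQ hac hcb
    have hX' := swapSet_subset hcQ hbQ hXQ
    have hY' := swapSet_subset hcQ hbQ hYQ
    have haX : ∀ Z : Finset α, a ∈ swapSet c b Z ↔ a ∈ Z := fun Z =>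
      mem_swapSet_of_ne hac.ne hab.ne
    have hbX : ∀ Z : Finset α, b ∈ swapSet a c Z ↔ b ∈ Z := fun Z =>
      mem_swapSet_of_ne hab.ne' hcb.ne'
    have step : f (wedgePair p (swapSet c b X) (swapSet c b Y)) =
        exchangePair q p a c (swapSet c b X) (swapSet c b Y) := by
      refine hfw _ _ hX' hY' (fun d hd h1 h2 => ?_) ?_ ?_
      · obtain ⟨h3, h4⟩ := hbetween d hd h1 (h2.trans hcb)
        exact ⟨(mem_swapSet_of_ne h2.ne (h2.trans hcb).ne).2 h3,
          (mem_swapSet_of_ne h2.ne (h2.trans hcb).ne).2 h4⟩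
      · rw [haX, haX]
        exact ha
      · rw [left_mem_swapSet, left_mem_swapSet]
        exact hb
    have back : shift q p c b b c (wedgePair p (swapSet c b X) (swapSet c b Y)) =
        wedgePair p X Y := by
      rw [shift_wedgePair_of_mem hqp hcb (.inr ⟨rfl, rfl⟩) (fun d hd => hadj d (hX' hd))
        (fun d hd => hadj d (hY' hd)) (right_mem_swapSet.2 hcX) (right_mem_swapSet.2 hcY)
        (by rw [left_mem_swapSet, left_mem_swapSet]; exact hb), swapSet_swapSet, swapSet_swapSet]
    have back' : shift q p c b b c (wedgePair p (swapSet a c (swapSet c b X))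
        (swapSet a c (swapSet c b Y))) = wedgePair p (swapSet a b X) (swapSet a b Y) := by
      rw [shift_wedgePair_of_mem hqp hcb (.inr ⟨rfl, rfl⟩)
        (fun d hd => hadj d (swapSet_subset haQ hcQ hX' hd))
        (fun d hd => hadj d (swapSet_subset haQ hcQ hY' hd))
        ((hbX _).2 (right_mem_swapSet.2 hcX)) ((hbX _).2 (right_mem_swapSet.2 hcY))
        (by rw [right_mem_swapSet, right_mem_swapSet, haX, haX]; exact ha),
        swapSet_conj hab.ne hac.ne hcb.ne', swapSet_conj hab.ne hac.ne hcb.ne']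
    rw [LinearMap.comp_apply, LinearMap.comp_apply,
      shift_wedgePair_of_mem hqp hcb (.inl ⟨rfl, rfl⟩) (fun d hd => hadj d (hXQ hd))
        (fun d hd => hadj d (hYQ hd)) hcX hcY hb, step, exchangePair, exchangePair]
    simp only [haX, left_mem_swapSet]
    split_ifs
    · rw [map_smul, back]
    · rw [map_sub, map_zero, back']
    · rw [map_sub, map_smul, back, back']

end Wedge

/-! ### Monomials with distinct rows and their relations -/

section Relations

/-- The free module on pairs of a row word and a column word; the pair of `z_1 ⋯ z_m` and
`w_1 ⋯ w_m` stands for the monomial `x_{z_1 w_1} ⋯ x_{z_m w_m}`. -/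
def RowColModule (R : Type*) [CommRing R] (β α : Type*) : Type _ := List β →₀ (List α →₀ R)

noncomputable instance (R : Type*) [CommRing R] (β α : Type*) : AddCommGroup (RowColModule R β α) :=
  inferInstanceAs (AddCommGroup (List β →₀ (List α →₀ R)))

noncomputable instance (R : Type*) [CommRing R] (β α : Type*) : Module R (RowColModule R β α) :=
  inferInstanceAs (Module R (List β →₀ (List α →₀ R)))

section

variable {R α β : Type*} [CommRing R]

/-- A linear combination of column words with a fixed row word. -/
noncomputable def mono (Z : List β) : (List α →₀ R) →ₗ[R] RowColModule R β α :=
  Finsupp.lsingle Z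

/-- A linear map on the free module on pairs of words, given by its values for each row word. -/
noncomputable def liftRows {M : Type*} [AddCommMonoid M] [Module R M]
    (g : List β → (List α →₀ R) →ₗ[R] M) : RowColModule R β α →ₗ[R] M :=
  Finsupp.lsum R g

@[simp] theorem liftRows_mono {M : Type*} [AddCommMonoid M] [Module R M]
    (g : List β → (List α →₀ R) →ₗ[R] M) (Z : List β) (v : List α →₀ R) :
    liftRows g (mono Z v) = g Z v :=
  Finsupp.lsum_single R g Z v

/-- Left multiplication by the generator `x_{z c}`. -/
noncomputable def consRowCol (R : Type*) [CommRing R] {α β : Type*} (z : β) (c : α) :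
    RowColModule R β α →ₗ[R] RowColModule R β α :=
  liftRows fun Z => mono (z :: Z) ∘ₗ consWord R c

@[simp] theorem consRowCol_single (z : β) (c : α) (Z : List β) (v : List α →₀ R) :
    consRowCol R z c (mono Z v) = mono (z :: Z) (consWord R c v) := by
  simp [consRowCol]

/-- Appending a word, as a linear map on the free module on words. -/
noncomputable def appendWord (R : Type*) [CommRing R] {α : Type*} (t : List α) :
    (List α →₀ R) →ₗ[R] (List α →₀ R) :=
  Finsupp.lmapDomain R R (· ++ t)

@[simp] theorem appendWord_single (t w : List α) (r : R) :
    appendWord R t (Finsupp.single w r) = Finsupp.single (w ++ t) r := by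
  simp [appendWord]

theorem appendWord_consWord (t : List α) (c : α) (v : List α →₀ R) :
    appendWord R t (consWord R c v) = consWord R c (appendWord R t v) := by
  induction v using Finsupp.induction_linear with
  | zero => simp
  | add f g hf hg => simp only [map_add, hf, hg]
  | single w r => simp

theorem appendWord_mem_wordSpan {Q : Set α} {t : List α} (ht : ∀ c ∈ t, c ∈ Q) {m : ℕ} {v : List α →₀ R}
    (hv : v ∈ wordSpan R Q m) : appendWord R t v ∈ wordSpan R Q (m + t.length) := by
  refine wordSpan_le_comap _ _ (fun w h1 h2 => ?_) hv
  rw [appendWord_single, ← h1, ← List.length_append]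
  refine single_mem_wordSpan fun c hc => ?_
  rcases List.mem_append.1 hc with h | h
  exacts [h2 c h, ht c h]

/-- Right multiplication by a monomial. -/
noncomputable def appendRowCol (R : Type*) [CommRing R] {α β : Type*} (v : List β) (t : List α) :
    RowColModule R β α →ₗ[R] RowColModule R β α :=
  liftRows fun Z => mono (Z ++ v) ∘ₗ appendWord R t

@[simp] theorem appendRowCol_single (v : List β) (t : List α) (Z : List β) (c : List α →₀ R) :
    appendRowCol R v t (mono Z c) = mono (Z ++ v) (appendWord R t c) := by
  simp [appendRowCol]

/-- The action of an operator on column words. -/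
noncomputable def colOperator (β : Type*) (f : (List α →₀ R) →ₗ[R] (List α →₀ R)) :
    RowColModule R β α →ₗ[R] RowColModule R β α :=
  liftRows fun Z => mono Z ∘ₗ f

@[simp] theorem colOperator_mono (f : (List α →₀ R) →ₗ[R] (List α →₀ R)) (Z : List β)
    (v : List α →₀ R) : colOperator β f (mono Z v) = mono Z (f v) := by
  simp [colOperator]

/-- The action of the transposition of the rows `a < b` on monomials: it exchanges `a` and `b`, with
a correction term if `b` does not stand before `a`. This is the left multiplication by a generator
of the Hecke algebra. -/
noncomputable def rowExchange [LinearOrder β] (q p : R) (a b : β) :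
    RowColModule R β α →ₗ[R] RowColModule R β α :=
  liftRows fun Z => mono (Z.map (Equiv.swap a b)) +
    if [b, a].Sublist Z then 0 else (p - q) • mono Z

theorem rowExchange_single [LinearOrder β] (q p : R) (a b : β) (Z : List β) (c : List α →₀ R) :
    rowExchange q p a b (mono Z c) = mono (Z.map (Equiv.swap a b)) c +
      if [b, a].Sublist Z then 0 else (p - q) • mono Z c := by
  rw [rowExchange, liftRows_mono]
  split_ifs <;> simp

end

variable {R α β : Type*} [CommRing R] [LinearOrder α] [LinearOrder β]

/-- The relations between the monomials `x_{z_1 w_1} ⋯ x_{z_m w_m}` with distinct rows `z_i ∈ U`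
and columns `w_i ∈ Q`, as a submodule of the free module on pairs of a row word and a column word:
if `i < k` then `x_{k l} x_{i j}` is rewritten by means of the braiding of `l` and `j`. -/
noncomputable def relations (q p : R) (U : Set β) (Q : Set α) :
    Submodule R (RowColModule R β α) :=
  Submodule.span R {e | ∃ (u : List β) (k i : β) (v : List β) (c : List α →₀ R),
    (u ++ k :: i :: v).Nodup ∧ (∀ z ∈ u ++ k :: i :: v, z ∈ U) ∧ i < k ∧
    c ∈ wordSpan R Q (u ++ k :: i :: v).length ∧
    e = mono (u ++ k :: i :: v) c -
      mono (u ++ i :: k :: v) (braid q p u.length c)}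

variable {q p : R} {U : Set β} {Q : Set α}

theorem single_sub_single_mem_relations {u v : List β} {k i : β} {c : List α →₀ R}
    (h1 : (u ++ k :: i :: v).Nodup) (h2 : ∀ z ∈ u ++ k :: i :: v, z ∈ U) (h3 : i < k)
    (h4 : c ∈ wordSpan R Q (u ++ k :: i :: v).length) :
    mono (u ++ k :: i :: v) c -
      mono (u ++ i :: k :: v) (braid q p u.length c) ∈ relations q p U Q :=
  Submodule.subset_span ⟨u, k, i, v, c, h1, h2, h3, h4, rfl⟩

theorem relations_le_comap {M : Type*} [AddCommMonoid M] [Module R M]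
    (f : RowColModule R β α →ₗ[R] M) (S : Submodule R M)
    (h : ∀ (u : List β) (k i : β) (v : List β) (c : List α →₀ R),
      (u ++ k :: i :: v).Nodup → (∀ z ∈ u ++ k :: i :: v, z ∈ U) → i < k →
      c ∈ wordSpan R Q (u ++ k :: i :: v).length →
      f (mono (u ++ k :: i :: v) c - mono (u ++ i :: k :: v) (braid q p u.length c)) ∈ S)
    {e : RowColModule R β α} (he : e ∈ relations q p U Q) : f e ∈ S := by
  have : relations q p U Q ≤ S.comap f := by
    refine Submodule.span_le.2 ?_
    rintro _ ⟨u, k, i, v, c, h1, h2, h3, h4, rfl⟩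
    exact h u k i v c h1 h2 h3 h4
  exact this he

theorem relations_mono {U' : Set β} {Q' : Set α} (hU : U ⊆ U') (hQ : Q ⊆ Q') :
    relations q p U Q ≤ relations q p U' Q' := by
  intro e he
  exact relations_le_comap LinearMap.id (relations q p U' Q') (fun u k i v c h1 h2 h3 h4 =>
    single_sub_single_mem_relations h1 (fun z hz => hU (h2 z hz)) h3 (wordSpan_mono hQ _ h4)) he

/-! ### Operations that preserve the relations -/

theorem consRowCol_mem_relations {z : β} {c : α} (hz : z ∈ U) (hc : c ∈ Q)
    {e : RowColModule R β α} (he : e ∈ relations q p (U \ {z}) Q) :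
    consRowCol R z c e ∈ relations q p U Q := by
  refine relations_le_comap (consRowCol R z c) (relations q p U Q) (fun u k i v w h1 h2 h3 h4 => ?_) he
  rw [map_sub, consRowCol_single, consRowCol_single, ← braid_succ]
  refine single_sub_single_mem_relations (u := z :: u) ?_ ?_ h3 (consWord_mem_wordSpan hc h4)
  · exact List.nodup_cons.2 ⟨fun h => (h2 z h).2 rfl, h1⟩
  · rintro y hy
    rcases List.mem_cons.1 hy with rfl | hy
    · exact hz
    · exact (h2 y hy).1

theorem appendWord_wedge (t : List α) (m : ℕ) (X : Finset α) (v : List α →₀ R) :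
    appendWord R t (wedge p m X v) = wedge p m X (appendWord R t v) := by
  induction m generalizing X with
  | zero => rfl
  | succ m ih => simp only [wedge_succ, map_sum, map_smul, appendWord_consWord, ih]

theorem braid_appendWord (t : List α) {m i : ℕ} (hi : i + 1 < m) {v : List α →₀ R}
    (hv : v ∈ wordSpan R Q m) :
    braid q p i (appendWord R t v) = appendWord R t (braid q p i v) := by
  refine wordSpan_ext (braid q p i ∘ₗ appendWord R t) (appendWord R t ∘ₗ braid q p i)
    (fun w h1 _ => ?_) hv
  clear hv
  simp only [LinearMap.comp_apply]
  induction i generalizing w m with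
  | zero =>
    match w with
    | [] => simp at h1; omega
    | [_] => simp at h1; omega
    | l :: j :: w =>
      have e : Finsupp.single (l :: j :: w) (1 : R) =
        consWord R l (consWord R j (Finsupp.single w 1)) := by simp
      rw [e, appendWord_consWord, appendWord_consWord]
      rcases lt_trichotomy l j with h | rfl | h
      · simp only [braid_zero_of_lt h, appendWord_consWord]
      · simp only [braid_zero_self, map_smul, appendWord_consWord]
      · simp only [braid_zero_of_gt h, map_sub, map_smul, appendWord_consWord]
  | succ i ih =>
    match w with
    | [] => simp at h1; omega
    | c :: w =>
      rename_i h2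
      have e : Finsupp.single (c :: w) (1 : R) = consWord R c (Finsupp.single w 1) := by simp
      rw [e, appendWord_consWord, braid_succ, braid_succ, appendWord_consWord,
        ih (m := w.length) (by simp at h1; omega) w rfl fun d hd => h2 d (by simp [hd])]

theorem appendRowCol_mem_relations {v : List β} {t : List α} (hv : v.Nodup)
    (hvU : ∀ z ∈ v, z ∈ U) (ht : ∀ c ∈ t, c ∈ Q) (hvt : v.length = t.length)
    {e : RowColModule R β α} (he : e ∈ relations q p (U \ {z | z ∈ v}) Q) :
    appendRowCol R v t e ∈ relations q p U Q := by
  refine relations_le_comap (appendRowCol R v t) (relations q p U Q) (fun u k i w c h1 h2 h3 h4 => ?_) he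
  rw [map_sub, appendRowCol_single, appendRowCol_single,
    ← braid_appendWord t (by simp) h4]
  have e1 : u ++ k :: i :: w ++ v = u ++ k :: i :: (w ++ v) := by simp
  have e2 : u ++ i :: k :: w ++ v = u ++ i :: k :: (w ++ v) := by simp
  have h4' := appendWord_mem_wordSpan ht h4
  rw [← hvt, ← List.length_append, e1] at h4'
  rw [e1, e2]
  refine single_sub_single_mem_relations ?_ ?_ h3 h4'
  · rw [← e1]
    refine List.Nodup.append h1 hv fun z hz hz' => (h2 z hz).2 hz'
  · rw [← e1]
    intro z hz
    rcases List.mem_append.1 hz with h | h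
    exacts [(h2 z h).1, hvU z h]

/-- A column operator commuting with the braiding preserves the relations. -/
theorem colOperator_mem_relations {f : (List α →₀ R) →ₗ[R] (List α →₀ R)}
    (hf : IsIntertwiner q p Q f) {e : RowColModule R β α} (he : e ∈ relations q p U Q) :
    colOperator β f e ∈ relations q p U Q := by
  refine relations_le_comap (colOperator β f) (relations q p U Q) (fun u k i v c h1 h2 h3 h4 => ?_) he
  obtain ⟨h5, h6⟩ := hf _ c h4
  rw [map_sub, colOperator_mono, colOperator_mono, h6]
  exact single_sub_single_mem_relations h1 h2 h3 h5

theorem map_swap_eq_self {γ : Type*} [DecidableEq γ] {a b : γ} {Z : List γ} (ha : a ∉ Z)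
    (hb : b ∉ Z) : Z.map (Equiv.swap a b) = Z := by
  rw [List.map_congr_left (g := id), List.map_id]
  intro c hc
  exact Equiv.swap_apply_of_ne_of_ne (by rintro rfl; exact ha hc) (by rintro rfl; exact hb hc)

theorem pair_sublist_swap_adjacent {γ : Type*} {x y k i : γ} (h1 : ¬ (x = k ∧ y = i))
    (h2 : ¬ (x = i ∧ y = k)) (u v : List γ) :
    [x, y].Sublist (u ++ k :: i :: v) ↔ [x, y].Sublist (u ++ i :: k :: v) := by
  classical
  have key : ∀ Z : List γ, [x, y].Sublist Z ↔
      [x, y].Sublist (Z.filter fun z => z = x ∨ z = y) := by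
    intro Z
    refine ⟨fun h => ?_, fun h => h.trans List.filter_sublist⟩
    simpa using h.filter fun z => decide (z = x ∨ z = y)
  rw [key, key (u ++ i :: k :: v)]
  have : (u ++ k :: i :: v).filter (fun z => z = x ∨ z = y) =
      (u ++ i :: k :: v).filter (fun z => z = x ∨ z = y) ∨ k = i := by
    by_cases hki : k = i
    · exact .inr hki
    left
    simp only [List.filter_append, List.filter_cons]
    by_cases hk : k = x ∨ k = y <;> by_cases hi : i = x ∨ i = y <;> simp [hk, hi]
    grind
  rcases this with h | rfl
  · rw [h]
  · rfl

theorem pair_sublist_iff_not {γ : Type*} {x y : γ} (hxy : x ≠ y) {Z : List γ} (hZ : Z.Nodup)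
    (hx : x ∈ Z) (hy : y ∈ Z) : [x, y].Sublist Z ↔ ¬ [y, x].Sublist Z := by
  induction Z with
  | nil => simp at hx
  | cons c Z ih =>
    obtain ⟨hc, hZ⟩ := List.nodup_cons.1 hZ
    rw [List.sublist_cons_iff, List.sublist_cons_iff]
    rcases List.mem_cons.1 hx with rfl | hxZ
    · have hy' : y ∈ Z := (List.mem_cons.1 hy).resolve_left hxy.symm
      have : ¬ [y, x].Sublist Z := fun h => hc (h.subset (by simp))
      simp [hy', this, hxy.symm]
    · rcases List.mem_cons.1 hy with rfl | hyZ
      · have : ¬ [x, y].Sublist Z := fun h => hc (h.subset (by simp))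
        simp [hxZ, this, hxy]
      · have h1 : x ≠ c := fun h => hc (h ▸ hxZ)
        have h2 : y ≠ c := fun h => hc (h ▸ hyZ)
        simp [h1, h2, ih hZ hxZ hyZ]

/-- If no row of `U` lies strictly between `a` and `b`, then the exchange of the rows `a` and `b`
preserves the relations: the only relation whose order of rows changes is the one exchanging `b` and
`a` themselves, and there the quadratic relation of the braiding gives the correction term. -/
theorem rowExchange_mem_relations (hqp : q * p = 1) {a b : β} (hab : a < b) (ha : a ∈ U)
    (hb : b ∈ U) (hU : ∀ z ∈ U, z ≤ a ∨ b ≤ z) {e : RowColModule R β α}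
    (he : e ∈ relations q p U Q) : rowExchange q p a b e ∈ relations q p U Q := by
  refine relations_le_comap (rowExchange q p a b) (relations q p U Q) (fun u k i v c h1 h2 h3 h4 => ?_) he
  have hi : i ∈ U := h2 i (by simp)
  have hk : k ∈ U := h2 k (by simp)
  rw [map_sub, rowExchange_single, rowExchange_single]
  by_cases hki : k = b ∧ i = a
  · obtain ⟨rfl, rfl⟩ := hki
    have h1' : (u ++ i :: k :: v).Nodup := by
      refine (List.Perm.nodup_iff ?_).1 h1
      exact (List.Perm.swap _ _ _).append_left u
    have s1 : [k, i].Sublist (u ++ k :: i :: v) := by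
      refine List.Sublist.trans ?_ (List.sublist_append_right _ _)
      simp
    have s2 : ¬ [k, i].Sublist (u ++ i :: k :: v) := by
      refine (pair_sublist_iff_not hab.ne h1' (by simp) (by simp)).1 ?_
      refine List.Sublist.trans ?_ (List.sublist_append_right _ _)
      simp
    have hn : i ∉ u ∧ k ∉ u ∧ i ∉ v ∧ k ∉ v := by
      simp only [List.nodup_append, List.nodup_cons] at h1
      grind
    have e1 : (u ++ k :: i :: v).map (Equiv.swap i k) = u ++ i :: k :: v := by
      simp [map_swap_eq_self hn.1 hn.2.1, map_swap_eq_self hn.2.2.1 hn.2.2.2]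
    have e2 : (u ++ i :: k :: v).map (Equiv.swap i k) = u ++ k :: i :: v := by
      simp [map_swap_eq_self hn.1 hn.2.1, map_swap_eq_self hn.2.2.1 hn.2.2.2]
    rw [if_pos s1, if_neg s2, e1, e2]
    have h5 := braid_mem_wordSpan (q := q) (p := p) u.length h4
    have := Submodule.neg_mem _ (single_sub_single_mem_relations (q := q) (p := p) h1 h2 h3 h5)
    rw [braid_braid hqp (by simp) h4] at this
    convert this using 1
    simp only [map_sub, map_smul]
    abel
  · have hsub : [b, a].Sublist (u ++ k :: i :: v) ↔ [b, a].Sublist (u ++ i :: k :: v) :=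
      pair_sublist_swap_adjacent (by tauto)
        (by rintro ⟨rfl, rfl⟩; exact h3.not_gt hab) u v
    have h3' : Equiv.swap a b i < Equiv.swap a b k :=
      (swap_lt_swap_iff hab (hU i hi) (hU k hk) (by tauto)
        (by rintro ⟨rfl, rfl⟩; exact h3.not_gt hab)).2 h3
    have hmem : ∀ z ∈ U, Equiv.swap a b z ∈ U := by
      intro z hz
      rw [Equiv.swap_apply_def]
      split_ifs <;> assumption
    have m1 := single_sub_single_mem_relations (q := q) (p := p) h1 h2 h3 h4
    have m2 : mono ((u ++ k :: i :: v).map (Equiv.swap a b)) c -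
        mono ((u ++ i :: k :: v).map (Equiv.swap a b)) (braid q p u.length c) ∈
        relations q p U Q := by
      have h1' : ((u ++ k :: i :: v).map (Equiv.swap a b)).Nodup :=
        h1.map (Equiv.swap a b).injective
      have h2' : ∀ z ∈ (u ++ k :: i :: v).map (Equiv.swap a b), z ∈ U := by
        intro z hz
        obtain ⟨y, hy, rfl⟩ := List.mem_map.1 hz
        exact hmem y (h2 y hy)
      have h4' : c ∈ wordSpan R Q ((u ++ k :: i :: v).map (Equiv.swap a b)).length := by
        rwa [List.length_map]
      simp only [List.map_append, List.map_cons] at h1' h2' h4' ⊢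
      have := single_sub_single_mem_relations (q := q) (p := p) h1' h2' h3' h4'
      rwa [List.length_map] at this
    by_cases hs : [b, a].Sublist (u ++ k :: i :: v)
    · rw [if_pos hs, if_pos (hsub.1 hs), add_zero, add_zero]
      exact m2
    · rw [if_neg hs, if_neg (hsub.not.1 hs)]
      convert Submodule.add_mem _ m2 (Submodule.smul_mem _ (p - q) m1) using 1
      module

end Relations

/-! ### Commuting minors past each other -/

section Base

variable {R α β : Type*} [CommRing R] [LinearOrder α] [LinearOrder β]
variable {q p : R} {U : Set β} {Q : Set α}

theorem consRowCol_smodEq {z : β} {c : α} (hz : z ∈ U) (hc : c ∈ Q) {e e' : RowColModule R β α}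
    (h : e ≡ e' [SMOD relations q p (U \ {z}) Q]) :
    consRowCol R z c e ≡ consRowCol R z c e' [SMOD relations q p U Q] := by
  rw [SModEq.sub_mem] at h ⊢
  rw [← map_sub]
  exact consRowCol_mem_relations hz hc h

theorem appendRowCol_smodEq {v : List β} {t : List α} (hv : v.Nodup)
    (hvU : ∀ z ∈ v, z ∈ U) (ht : ∀ c ∈ t, c ∈ Q) (hvt : v.length = t.length)
    {e e' : RowColModule R β α} (h : e ≡ e' [SMOD relations q p (U \ {z | z ∈ v}) Q]) :
    appendRowCol R v t e ≡ appendRowCol R v t e' [SMOD relations q p U Q] := by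
  rw [SModEq.sub_mem] at h ⊢
  rw [← map_sub]
  exact appendRowCol_mem_relations hv hvU ht hvt h

theorem colOperator_smodEq {f : (List α →₀ R) →ₗ[R] (List α →₀ R)} (hf : IsIntertwiner q p Q f)
    {e e' : RowColModule R β α} (h : e ≡ e' [SMOD relations q p U Q]) :
    colOperator β f e ≡ colOperator β f e' [SMOD relations q p U Q] := by
  rw [SModEq.sub_mem] at h ⊢
  rw [← map_sub]
  exact colOperator_mem_relations hf h

theorem rowExchange_smodEq (hqp : q * p = 1) {a b : β} (hab : a < b) (ha : a ∈ U)
    (hb : b ∈ U) (hU : ∀ z ∈ U, z ≤ a ∨ b ≤ z) {e e' : RowColModule R β α}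
    (h : e ≡ e' [SMOD relations q p U Q]) :
    rowExchange q p a b e ≡ rowExchange q p a b e' [SMOD relations q p U Q] := by
  rw [SModEq.sub_mem] at h ⊢
  rw [← map_sub]
  exact rowExchange_mem_relations hqp hab ha hb hU h

/-- The generator `x_{k l}` `q`-commutes with a minor with rows `< k` and columns `≥ l`. -/
theorem mono_cons_wedge_of_le {k : β} {Z v : List β} {l : α} {J : Finset α} {t : List α →₀ R}
    (hnd : (k :: (Z ++ v)).Nodup) (hU : ∀ z ∈ k :: (Z ++ v), z ∈ U) (hk : ∀ z ∈ Z, z < k)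
    (hl : l ∈ Q) (hJ : ∀ c ∈ J, c ∈ Q) (hle : ∀ c ∈ J, l ≤ c) (hZ : J.card = Z.length)
    (ht : t ∈ wordSpan R Q v.length) :
    mono (k :: (Z ++ v)) (consWord R l (wedge p Z.length J t)) ≡
      (if l ∈ J then q else 1) • mono (Z ++ k :: v) (wedge p Z.length J (consWord R l t))
      [SMOD relations q p U Q] := by
  induction Z generalizing U J with
  | nil =>
    obtain rfl := Finset.card_eq_zero.1 hZ
    simp
  | cons z Z ih =>
    simp only [List.length_cons, wedge_succ, map_sum, map_smul, Finset.smul_sum]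
    refine SModEq.sum fun c hc => ?_
    rw [smul_comm]
    refine SModEq.smul ?_ _
    have hcard : (J.erase c).card = Z.length := by
      rw [Finset.card_erase_of_mem hc, hZ]
      rfl
    have hJ' : ∀ d ∈ J.erase c, d ∈ Q := fun d hd => hJ d (Finset.mem_of_mem_erase hd)
    have hw : wedge p Z.length (J.erase c) t ∈ wordSpan R Q (Z ++ v).length := by
      rw [List.length_append, add_comm]
      exact wedge_mem_wordSpan hJ' ht
    have h1 := single_sub_single_mem_relations (q := q) (p := p) (u := []) hnd hU
      (hk z (by simp)) (consWord_mem_wordSpan hl (consWord_mem_wordSpan (hJ c hc) hw))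
    have h2 : braid q p 0 (consWord R l (consWord R c (wedge p Z.length (J.erase c) t))) =
        (if l = c then q else 1) • consWord R c (consWord R l (wedge p Z.length (J.erase c) t)) := by
      rcases (hle c hc).eq_or_lt with h | h
      · subst h
        rw [braid_zero_self, if_pos rfl]
      · rw [braid_zero_of_lt h, if_neg h.ne, one_smul]
    simp only [List.nil_append, List.length_nil, h2] at h1
    refine (SModEq.sub_mem.2 h1).trans ?_
    have hnd' : (k :: (Z ++ v)).Nodup := by
      simp only [List.cons_append, List.nodup_cons, List.mem_cons] at hnd ⊢
      tauto
    have hz : z ∉ k :: (Z ++ v) := by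
      simp only [List.cons_append, List.nodup_cons, List.mem_cons] at hnd ⊢
      rintro (rfl | h)
      · exact hnd.1 (.inl rfl)
      · exact hnd.2.1 h
    have h3 := ih (U := U \ {z}) (J := J.erase c) hnd'
      (fun y hy => ⟨hU y (by simp at hy ⊢; tauto), fun h => hz (h ▸ hy)⟩)
      (fun y hy => hk y (by simp [hy])) hJ' (fun d hd => hle d (Finset.mem_of_mem_erase hd)) hcard
    have h4 := (consRowCol_smodEq (hU z (by simp)) (hJ c hc) h3).smul (if l = c then q else 1)
    rw [map_smul, consRowCol_single, consRowCol_single, smul_smul] at h4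
    have hs : ((if l = c then q else 1) * if l ∈ J.erase c then q else 1) =
        if l ∈ J then q else 1 := by
      by_cases h : l = c
      · subst h
        simp [hc]
      · simp [h]
    rw [hs] at h4
    rw [map_smul]
    exact h4

/-- The generator `x_{k l}` `q`-commutes with a minor with rows `< k` one of whose columns is
`l`. If `l` is its first column this holds factor by factor, and root vectors move `l`. -/
theorem mono_cons_wedge_of_mem (hqp : q * p = 1) {k : β} {Z : List β} {l : α} {J : Finset α}
    (hnd : (k :: Z).Nodup) (hU : ∀ z ∈ k :: Z, z ∈ U) (hk : ∀ z ∈ Z, z < k)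
    (hl : l ∈ J) (hZ : J.card = Z.length) :
    mono (k :: Z) (consWord R l (wedge p Z.length J (Finsupp.single [] 1))) ≡
      q • mono (Z ++ [k]) (wedge p Z.length J (Finsupp.single [l] 1))
      [SMOD relations q p U (J : Set α)] := by
  induction hn : (J.filter (· < l)).card using Nat.strong_induction_on generalizing l with
  | _ n ih =>
    rcases (J.filter (· < l)).eq_empty_or_nonempty with he | hne
    · have := mono_cons_wedge_of_le (q := q) (p := p) (U := U) (Q := (J : Set α)) (v := []) (l := l)
        (t := Finsupp.single [] 1) (k := k) (Z := Z) (J := J) (by simpa using hnd) (by simpa using hU)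
        hk hl (fun c hc => hc)
        (fun c hc => by
          by_contra! h
          rw [Finset.filter_eq_empty_iff] at he
          exact he hc h) hZ (single_mem_wordSpan (w := []) (by simp))
      simpa [hl] using this
    · obtain ⟨c, hc, hmax⟩ := Finset.exists_max_image _ id hne
      obtain ⟨hcJ, hcl⟩ : c ∈ J ∧ c < l := by simpa using hc
      have hadj : ∀ d ∈ J, d ≤ c ∨ l ≤ d := by
        intro d hd
        by_contra! h
        exact (hmax d (by simp [hd, h.2])).not_gt h.1
      have h1 := ih _ (by
        rw [← hn]
        refine Finset.card_lt_card ⟨fun d hd => ?_, fun h => ?_⟩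
        · simp only [Finset.mem_filter] at hd ⊢
          exact ⟨hd.1, hd.2.trans hcl⟩
        · simpa using h hc) hcJ rfl
      have h2 := colOperator_smodEq (isIntertwiner_shift hqp hcl (.inl ⟨rfl, rfl⟩) hl hadj) h1
      have e : Finsupp.single [c] (1 : R) = consWord R c (Finsupp.single [] 1) := by simp
      rw [map_smul, colOperator_mono, colOperator_mono, shift_cons,
        shift_wedge hqp hcl (.inl ⟨rfl, rfl⟩) hadj hZ, shift_wedge hqp hcl (.inl ⟨rfl, rfl⟩) hadj hZ,
        e, shift_cons, setWeight_eq hqp hcl.ne] at h2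
      simpa [hl, hcJ] using h2

theorem mono_cons_wedge (hqp : q * p = 1) {k : β} {Z v : List β} {l : α} {J : Finset α}
    {t : List α →₀ R}
    (hnd : (k :: (Z ++ v)).Nodup) (hU : ∀ z ∈ k :: (Z ++ v), z ∈ U) (hk : ∀ z ∈ Z, z < k)
    (hl : l ∈ Q) (hJ : ∀ c ∈ J, c ∈ Q) (hle : l ∈ J ∨ ∀ c ∈ J, l ≤ c) (hZ : J.card = Z.length)
    (ht : t ∈ wordSpan R Q v.length) :
    mono (k :: (Z ++ v)) (consWord R l (wedge p Z.length J t)) ≡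
      (if l ∈ J then q else 1) • mono (Z ++ k :: v) (wedge p Z.length J (consWord R l t))
      [SMOD relations q p U Q] := by
  rcases hle with hlJ | hle
  · rw [if_pos hlJ, SModEq.sub_mem]
    refine wordSpan_le_comap (mono (k :: (Z ++ v)) ∘ₗ consWord R l ∘ₗ wedge p Z.length J -
      q • (mono (Z ++ k :: v) ∘ₗ wedge p Z.length J ∘ₗ consWord R l)) (relations q p U Q)
      (fun w h1 h2 => ?_) ht
    have hnd' : (k :: Z).Nodup ∧ v.Nodup ∧ ∀ z ∈ k :: Z, z ∉ v := by
      rw [← List.cons_append] at hnd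
      obtain ⟨h3, h4, h5⟩ := List.nodup_append.1 hnd
      exact ⟨h3, h4, fun z hz hz' => h5 z hz z hz' rfl⟩
    have h := mono_cons_wedge_of_mem hqp (U := U \ {z | z ∈ v}) hnd'.1
      (fun z hz => ⟨hU z (by simp at hz ⊢; tauto), hnd'.2.2 z hz⟩) hk hlJ hZ
    have h' := appendRowCol_smodEq (t := w) hnd'.2.1 (fun z hz => hU z (by simp [hz])) h2 h1.symm
      (SModEq.mono (relations_mono le_rfl hJ) h)
    rw [map_smul, appendRowCol_single, appendRowCol_single, appendWord_consWord, appendWord_wedge,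
      appendWord_wedge, appendWord_single, appendWord_single, SModEq.sub_mem] at h'
    simpa using h'
  · exact mono_cons_wedge_of_le hnd hU hk hl hJ hle hZ ht

/-- A minor `q`-commutes with a minor in smaller rows, if each of its columns is a column of the
other minor or smaller than all of these. -/
theorem mono_wedge_wedge_of_le (hqp : q * p = 1) {K Z : List β} {L J : Finset α}
    (hnd : (K ++ Z).Nodup) (hU : ∀ z ∈ K ++ Z, z ∈ U) (hk : ∀ k ∈ K, ∀ z ∈ Z, z < k)
    (hL : ∀ c ∈ L, c ∈ Q) (hJ : ∀ c ∈ J, c ∈ Q) (hle : ∀ l ∈ L, l ∈ J ∨ ∀ c ∈ J, l ≤ c)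
    (hZ : J.card = Z.length) (hK : L.card = K.length) :
    mono (K ++ Z) (wedge p K.length L (wedge p Z.length J (Finsupp.single [] 1))) ≡
      q ^ (L ∩ J).card •
        mono (Z ++ K) (wedge p Z.length J (wedge p K.length L (Finsupp.single [] 1)))
      [SMOD relations q p U Q] := by
  induction K generalizing U L with
  | nil =>
    obtain rfl := Finset.card_eq_zero.1 hK
    simp
  | cons k K ih =>
    simp only [List.length_cons, wedge_succ, map_sum, map_smul, Finset.smul_sum]
    refine SModEq.sum fun l hl => ?_
    rw [smul_comm]
    refine SModEq.smul ?_ _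
    obtain ⟨hk', hnd'⟩ := List.nodup_cons.1 hnd
    have hcard : (L.erase l).card = K.length := by
      rw [Finset.card_erase_of_mem hl, hK]
      rfl
    have hL' : ∀ d ∈ L.erase l, d ∈ Q := fun d hd => hL d (Finset.mem_of_mem_erase hd)
    have h1 := ih (U := U \ {k}) (L := L.erase l) hnd'
      (fun y hy => ⟨hU y (List.mem_cons_of_mem _ hy), fun h => hk' (h ▸ hy)⟩)
      (fun y hy => hk y (by simp [hy])) hL' (fun d hd => hle d (Finset.mem_of_mem_erase hd)) hcard
    have h2 := consRowCol_smodEq (hU k (by simp)) (hL l hl) h1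
    rw [map_smul, consRowCol_single, consRowCol_single] at h2
    refine h2.trans ?_
    have hnd'' : (k :: (Z ++ K)).Nodup := by
      refine (List.Perm.nodup_iff ?_).1 hnd
      exact List.Perm.cons _ List.perm_append_comm
    have h3 := mono_cons_wedge hqp (U := U) (Q := Q) (J := J) (l := l)
      (t := wedge p K.length (L.erase l) (Finsupp.single [] 1)) hnd''
      (fun y hy => hU y (by simp at hy ⊢; tauto)) (hk k (by simp)) (hL l hl) hJ (hle l hl) hZ
      (by simpa using wedge_mem_wordSpan (m := K.length) hL' (single_mem_wordSpan (w := []) (by simp)))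
    have h4 := h3.smul (q ^ (L.erase l ∩ J).card)
    rw [smul_smul] at h4
    convert h4 using 2
    rw [Finset.erase_inter]
    by_cases h : l ∈ J
    · rw [if_pos h, ← pow_succ, Finset.card_erase_add_one (by simp [h, hl])]
    · rw [if_neg h, mul_one, Finset.erase_eq_of_notMem (by simp [h])]

/-- Products of minors `[K, L] [Z, J]`, where the rows in `K` are larger than those in `Z`, and
where the columns of `L` not in `J` are smaller than those of `J` not in `L`, are `q`-commuting.
Root vectors reduce this to the case in which the common columns do not precede columns of `L`. -/
theorem mono_wedgePair (hqp : q * p = 1) {K Z : List β} {L J Q : Finset α}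
    (hnd : (K ++ Z).Nodup) (hU : ∀ z ∈ K ++ Z, z ∈ U) (hk : ∀ k ∈ K, ∀ z ∈ Z, z < k)
    (hQ : Q = L ∪ J) (hle : ∀ l ∈ L, l ∉ J → ∀ j ∈ J, j ∉ L → l < j)
    (hZ : J.card = Z.length) (hK : L.card = K.length) :
    mono (K ++ Z) (wedgePair p L J) ≡ q ^ (L ∩ J).card • mono (Z ++ K) (wedgePair p J L)
      [SMOD relations q p U (Q : Set α)] := by
  induction hn : ∑ j ∈ J, (L.filter (j < ·)).card using Nat.strong_induction_on generalizing J with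
  | _ n ih =>
    by_cases hgood : ∀ l ∈ L, l ∈ J ∨ ∀ c ∈ J, l ≤ c
    · have := mono_wedge_wedge_of_le hqp (U := U) (Q := (Q : Set α)) hnd hU hk (L := L) (J := J)
        (by rw [hQ]; intro c hc; simp [hc]) (by rw [hQ]; intro c hc; simp [hc]) hgood hZ hK
      rwa [← hZ, ← hK] at this
    · push Not at hgood
      obtain ⟨l₀, hl₀, hl₀J, c₀, hc₀, hc₀l₀⟩ := hgood
      have hc₀L : c₀ ∈ L := by
        by_contra h
        exact (hle l₀ hl₀ hl₀J c₀ hc₀ h).not_gt hc₀l₀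
      -- an adjacent pair of a common column and a larger column of `L` not in `J`
      obtain ⟨l, hl, hlmin⟩ := Finset.exists_min_image (L.filter fun d => d ∉ J ∧ c₀ < d) id
        ⟨l₀, by simp [hl₀, hl₀J, hc₀l₀]⟩
      obtain ⟨hlL, hlJ, hc₀l⟩ : l ∈ L ∧ l ∉ J ∧ c₀ < l := by simpa using hl
      obtain ⟨c, hc, hcmax⟩ := Finset.exists_max_image (J.filter fun d => d ∈ L ∧ d < l) id
        ⟨c₀, by simp [hc₀, hc₀L, hc₀l]⟩
      obtain ⟨hcJ, hcL, hcl⟩ : c ∈ J ∧ c ∈ L ∧ c < l := by simpa using hc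
      have hc₀c : c₀ ≤ c := hcmax c₀ (by simp [hc₀, hc₀L, hc₀l])
      have hadj : ∀ d ∈ Q, d ≤ c ∨ l ≤ d := by
        intro d hd
        by_contra! h
        by_cases hdJ : d ∈ J
        · by_cases hdL : d ∈ L
          · exact (hcmax d (by simp [hdJ, hdL, h.2])).not_gt h.1
          · exact (hle l hlL hlJ d hdJ hdL).not_gt h.2
        · have hdL : d ∈ L := by simpa [hQ, hdJ] using hd
          exact (hlmin d (by simp [hdJ, hdL, hc₀c.trans_lt h.1])).not_gt h.2
      have hLQ : L ⊆ Q := hQ ▸ Finset.subset_union_left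
      have hJQ : J ⊆ Q := hQ ▸ Finset.subset_union_right
      have hmem : ∀ d, d ≠ c → d ≠ l → (d ∈ swapSet c l J ↔ d ∈ J) := fun d h1 h2 =>
        mem_swapSet_of_ne h1 h2
      have hL : swapSet c l L = L := swapSet_eq_self (by simp [hcL, hlL])
      have hQ' : Q = L ∪ swapSet c l J := by
        rw [hQ]
        ext d
        by_cases h1 : d = c
        · simp [h1, hcL]
        by_cases h2 : d = l
        · simp [h2, hlL]
        rw [Finset.mem_union, Finset.mem_union, hmem d h1 h2]
      have hinter : L ∩ swapSet c l J = swapSet c l (L ∩ J) := by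
        rw [swapSet, swapSet, Finset.map_inter]
        congr 1
        exact hL.symm
      have h1 := ih (∑ j ∈ swapSet c l J, (L.filter (j < ·)).card) (by
          have e1 : swapSet c l J = insert l (J.erase c) := by
            ext d
            by_cases h1 : d = c
            · simp [h1, hlJ, hcl.ne]
            by_cases h2 : d = l
            · simp [h2, hcJ]
            rw [hmem d h1 h2]
            simp [h1, h2]
          rw [← hn, e1, Finset.sum_insert (by simp [hlJ]), ← Finset.add_sum_erase J _ hcJ]
          refine Nat.add_lt_add_right (Finset.card_lt_card ⟨fun d hd => ?_, fun h => ?_⟩) _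
          · simp only [Finset.mem_filter] at hd ⊢
            exact ⟨hd.1, hcl.trans hd.2⟩
          · have := h (show l ∈ L.filter (c < ·) by simp [hlL, hcl])
            simp at this) hQ' (by
          intro d hd hdJ j hj hjL
          have hj1 : j ≠ c := by rintro rfl; exact hjL hcL
          have hj2 : j ≠ l := by rintro rfl; exact hjL hlL
          rw [hmem j hj1 hj2] at hj
          by_cases h2 : d = l
          · rw [h2]
            exact hle l hlL hlJ j hj hjL
          by_cases h1 : d = c
          · rw [h1]
            exact hcl.trans (hle l hlL hlJ j hj hjL)
          · exact hle d hd (by rwa [hmem d h1 h2] at hdJ) j hj hjL) (by rw [card_swapSet, hZ]) rfl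
      have h2 := colOperator_smodEq
        (isIntertwiner_shift hqp hcl (.inr ⟨rfl, rfl⟩) (hLQ hcL) hadj) h1
      have hadj1 : ∀ d ∈ L, d ≤ c ∨ l ≤ d := fun d hd => hadj d (hLQ hd)
      have hadj2 : ∀ d ∈ swapSet c l J, d ≤ c ∨ l ≤ d := fun d hd =>
        hadj d (swapSet_subset (hLQ hcL) (hLQ hlL) hJQ hd)
      rwa [map_smul, colOperator_mono, colOperator_mono,
        shift_wedgePair_of_mem hqp hcl (.inr ⟨rfl, rfl⟩) hadj1 hadj2 hlL (by simp [hcJ])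
          (by simp [hcL, hlJ]),
        shift_wedgePair_of_mem hqp hcl (.inr ⟨rfl, rfl⟩) hadj2 hadj1 (by simp [hcJ]) hlL
          (by simp [hcL, hlJ]), swapSet_swapSet, hL, hinter, card_swapSet] at h2

end Base

/-! ### Evaluation in the quantum matrix algebra -/

section Evaluation

open LaurentPolynomial in
theorem T_one_mul_T_neg_one (k : Type*) [Field k] :
    (T 1 : LaurentPolynomial k) * T (-1) = 1 := by
  rw [← T_add]
  simp

variable (k : Type*) [Field k] {n : ℕ}

open LaurentPolynomial in
/-- The relation that expresses `x_{r l} x_{i j}` with `i < r` by monomials with rows `i`, `r`, in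
the case `j < l`. -/
theorem x_mul_x_of_gt {i r j l : Fin n} (hr : i < r) (hc : j < l) :
    x k r l * x k i j = x k i j * x k r l -
      (T (-1) - T 1 : LaurentPolynomial k) • (x k i l * x k r j) := by
  have h1 := RingQuot.mkAlgHom_rel (LaurentPolynomial k) (ManinRel.cross (k := k) i j r l hr hc)
  have h2 := RingQuot.mkAlgHom_rel (LaurentPolynomial k)
    (ManinRel.comm (k := k) r j i l (.inr ⟨hr, hc⟩))
  rw [map_sub, map_smul, map_mul, map_mul, map_mul] at h1
  rw [map_mul, map_mul] at h2
  rw [h2] at h1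
  exact @eq_sub_of_add_eq (QMat k n) _ _ _ _ ((add_comm _ _).trans (sub_eq_iff_eq_add.1 h1).symm)

theorem x_mul_x_of_lt {i r j l : Fin n} (hr : i < r) (hc : l < j) :
    x k r l * x k i j = x k i j * x k r l := by
  have h1 := RingQuot.mkAlgHom_rel (LaurentPolynomial k)
    (ManinRel.comm (k := k) i j r l (.inl ⟨hr, hc⟩))
  rw [map_mul, map_mul] at h1
  exact h1.symm

open LaurentPolynomial in
theorem x_mul_x_same_col {i r j : Fin n} (hr : i < r) :
    x k r j * x k i j = (T 1 : LaurentPolynomial k) • (x k i j * x k r j) := by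
  have h1 := RingQuot.mkAlgHom_rel (LaurentPolynomial k) (ManinRel.col (k := k) j i r hr)
  rw [map_smul, map_mul, map_mul] at h1
  change x k i j * x k r j = (T (-1) : LaurentPolynomial k) • (x k r j * x k i j) at h1
  rw [h1, smul_smul, T_one_mul_T_neg_one, one_smul]

/-- The evaluation of pairs of words as monomials of the quantum matrix algebra. -/
noncomputable def evalMono : RowColModule (LaurentPolynomial k) (Fin n) (Fin n)
    →ₗ[LaurentPolynomial k] QMat k n :=
  liftRows fun Z => Finsupp.linearCombination (LaurentPolynomial k)
    fun w => (List.zipWith (x k) Z w).prod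

theorem evalMono_single (Z w : List (Fin n)) :
    evalMono k (mono Z (Finsupp.single w 1)) = (List.zipWith (x k) Z w).prod := by
  simp [evalMono]

theorem evalMono_cons (z c : Fin n) (Z : List (Fin n))
    (v : List (Fin n) →₀ LaurentPolynomial k) :
    evalMono k (mono (z :: Z) (consWord _ c v)) = x k z c * evalMono k (mono Z v) := by
  induction v using Finsupp.induction_linear with
  | zero => simp
  | add f g hf hg => simp only [map_add, hf, hg, mul_add]
  | single w r => simp [evalMono]

open LaurentPolynomial in
/-- The relations hold in the quantum matrix algebra. -/
theorem evalMono_eq_zero {U Q : Set (Fin n)} {e : RowColModule (LaurentPolynomial k) (Fin n) (Fin n)}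
    (he : e ∈ relations (T 1) (T (-1)) U Q) : evalMono k e = 0 := by
  have h0 := relations_le_comap (R := LaurentPolynomial k) (M := QMat k n) (evalMono k) ⊥ (fun u r i v c hnd hU h3 h4 => ?_) he
  · exact (Submodule.mem_bot (LaurentPolynomial k)).1 h0
  rw [Submodule.mem_bot, map_sub, sub_eq_zero]
  refine wordSpan_ext (R := LaurentPolynomial k) (M := QMat k n)
    ((evalMono k : _ →ₗ[LaurentPolynomial k] QMat k n) ∘ₗ mono (u ++ r :: i :: v))
    (evalMono k ∘ₗ mono (u ++ i :: r :: v) ∘ₗ braid (T 1) (T (-1)) u.length) (fun w h1 _ => ?_) h4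
  clear h4 hnd hU
  simp only [LinearMap.comp_apply]
  induction u generalizing w with
  | nil =>
    match w with
    | [] => simp at h1
    | [_] => simp at h1
    | l :: j :: w =>
      have e : Finsupp.single (l :: j :: w) (1 : LaurentPolynomial k) =
        consWord _ l (consWord _ j (Finsupp.single w 1)) := by simp
      rw [e, List.length_nil, List.nil_append, List.nil_append]
      rcases lt_trichotomy l j with h | rfl | h
      · rw [braid_zero_of_lt h]
        simp only [evalMono_cons, ← mul_assoc, x_mul_x_of_lt k h3 h]
      · rw [braid_zero_self, map_smul, map_smul]
        simp only [evalMono_cons, ← mul_assoc, x_mul_x_same_col k h3, smul_mul_assoc]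
      · rw [braid_zero_of_gt h, map_sub, map_sub, map_smul, map_smul]
        simp only [evalMono_cons, ← mul_assoc, x_mul_x_of_gt k h3 h]
        refine (@sub_mul (QMat k n) _ _ _ _).trans ?_
        rw [smul_mul_assoc]
  | cons z u ih =>
    match w with
    | [] => simp at h1
    | c :: w =>
      have e : Finsupp.single (c :: w) (1 : LaurentPolynomial k) =
        consWord _ c (Finsupp.single w 1) := by simp
      rename_i h2
      rw [e, List.length_cons, braid_succ, List.cons_append, List.cons_append, evalMono_cons,
        evalMono_cons, ih w (by simpa using h1) fun d hd => h2 d (by simp [hd])]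

theorem inversions_succ {α : Type*} [LinearOrder α] {m : ℕ} (w : Fin (m + 1) → α) :
    inversions w = (Finset.univ.filter fun i : Fin m => w i.succ < w 0).card +
      inversions fun i => w i.succ := by
  simp only [inversions, Finset.card_filter, Fintype.sum_prod_type, Fin.sum_univ_succ]
  simp [Fin.succ_pos]

/-- Expansion of a quantum minor along its first row. -/
theorem minor_cons (z : Fin n) (Z : List (Fin n)) (J : Finset (Fin n)) :
    minor k (z :: Z) J = ∑ c ∈ J,
      (-(LaurentPolynomial.T (-1)) : LaurentPolynomial k) ^ (J.filter (· < c)).card •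
        (x k z c * minor k Z (J.erase c)) := by
  simp only [minor, Finset.mul_sum, Finset.smul_sum]
  rw [Finset.sum_sigma']
  have himage : ∀ w : Fin (Z.length + 1) → Fin n, Function.Injective w → Finset.univ.image w = J →
      Finset.univ.image (fun i => w (Fin.succ i)) = J.erase (w 0) := by
    rintro w h1 rfl
    ext c
    simp only [Finset.mem_image, Finset.mem_univ, true_and, Finset.mem_erase]
    constructor
    · rintro ⟨i, rfl⟩
      exact ⟨fun h => Fin.succ_ne_zero i (h1 h), _, rfl⟩
    · rintro ⟨h2, i, rfl⟩
      obtain ⟨j, rfl⟩ := Fin.exists_succ_eq.2 fun h : i = 0 => h2 (h ▸ rfl)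
      exact ⟨j, rfl⟩
  refine Finset.sum_bij' (fun (w : Fin (Z.length + 1) → Fin n) _ => ⟨w 0, fun i => w i.succ⟩)
    (fun s _ => (Fin.cons s.1 s.2 : Fin (Z.length + 1) → Fin n)) ?_ ?_ ?_ ?_ ?_
  · intro w hw
    obtain ⟨h1, h2⟩ := (Finset.mem_filter.1 hw).2
    simp only [Finset.mem_sigma, Finset.mem_filter, Finset.mem_univ, true_and]
    refine ⟨?_, fun i j h => Fin.succ_injective _ (h1 h), himage w h1 h2⟩
    rw [← h2]
    exact Finset.mem_image_of_mem _ (Finset.mem_univ _)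
  · rintro ⟨c, w⟩ hw
    simp only [Finset.mem_sigma, Finset.mem_filter, Finset.mem_univ, true_and] at hw ⊢
    obtain ⟨hc, h1, h2⟩ := hw
    refine ⟨Fin.cons_injective_iff.2 ⟨?_, h1⟩, ?_⟩
    · rintro ⟨i, rfl⟩
      have := Finset.mem_image_of_mem w (Finset.mem_univ i)
      rw [h2] at this
      simp at this
    · rw [← Finset.insert_erase hc, ← h2]
      ext d
      simp only [Finset.mem_image, Finset.mem_univ, true_and, Finset.mem_insert]
      exact Fin.exists_fin_succ.trans (by simp [eq_comm])
  · intro w hw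
    exact Fin.cons_self_tail (α := fun _ => Fin n) w
  · rintro ⟨c, w⟩ hw
    rfl
  · intro w hw
    obtain ⟨h1, h2⟩ := (Finset.mem_filter.1 hw).2
    have h3 : (Finset.univ.filter fun i : Fin Z.length => w i.succ < w 0).card =
        (J.filter (· < w 0)).card := by
      have : J.filter (· < w 0) = (Finset.univ.filter fun i : Fin Z.length =>
          w (Fin.succ i) < w 0).image fun i => w (Fin.succ i) := by
        rw [← Finset.filter_image (p := (· < w 0)), himage w h1 h2, Finset.filter_erase]
        simp
      rw [this, Finset.card_image_of_injective _ fun i j h => Fin.succ_injective _ (h1 h)]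
    have h4 := inversions_succ (m := Z.length) w
    rw [h3] at h4
    have h5 : (List.ofFn fun i : Fin (Z.length + 1) => x k ((z :: Z).get i) (w i)).prod =
        x k z (w 0) * (List.ofFn fun i : Fin Z.length => x k (Z.get i) (w i.succ)).prod := by
      rw [List.ofFn_succ, List.prod_cons]
      rfl
    rw [mul_smul_comm, smul_smul, ← pow_add, ← h4]
    exact congrArg _ h5

theorem evalMono_wedge {Z Z' : List (Fin n)} {J : Finset (Fin n)} (hJ : J.card = Z.length)
    (v : List (Fin n) →₀ LaurentPolynomial k) :
    evalMono k (mono (Z ++ Z') (wedge (LaurentPolynomial.T (-1)) Z.length J v)) =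
      minor k Z J * evalMono k (mono Z' v) := by
  induction Z generalizing J with
  | nil =>
    obtain rfl := Finset.card_eq_zero.1 hJ
    simp [minor, inversions, Function.injective_of_subsingleton]
  | cons z Z ih =>
    rw [List.length_cons, wedge_succ, minor_cons, map_sum, map_sum, Finset.sum_mul]
    refine Finset.sum_congr rfl fun c hc => ?_
    rw [map_smul, map_smul, List.cons_append, evalMono_cons, ih, smul_mul_assoc, mul_assoc]
    rw [Finset.card_erase_of_mem hc, hJ]
    rfl

theorem evalMono_wedgePair {Z Z' : List (Fin n)} {J J' : Finset (Fin n)} (hJ : J.card = Z.length)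
    (hJ' : J'.card = Z'.length) :
    evalMono k (mono (Z ++ Z') (wedgePair (LaurentPolynomial.T (-1)) J J')) =
      minor k Z J * minor k Z' J' := by
  have h := evalMono_wedge k (Z' := []) hJ' (Finsupp.single [] 1)
  rw [List.append_nil, evalMono_single] at h
  rw [wedgePair, hJ, evalMono_wedge k hJ, hJ', h]
  simp

end Evaluation

/-! ### Standard towers -/

section Towers

variable {α : Type*} [LinearOrder α]

theorem le_or_le_of_mem_consecutive {U : Finset α} {p : α × α} (h : p ∈ consecutive U) :
    ∀ z ∈ U, z ≤ p.1 ∨ p.2 ≤ z := by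
  have key : ∀ l : List α, l.Pairwise (· < ·) → p ∈ l.zip l.tail →
      ∀ z ∈ l, z ≤ p.1 ∨ p.2 ≤ z := by
    intro l
    induction l with
    | nil => simp
    | cons a l ih =>
      cases l with
      | nil => simp
      | cons b l =>
        intro hs hp z hz
        rw [List.tail_cons, List.zip_cons_cons, List.mem_cons] at hp
        obtain ⟨h1, h2⟩ := List.pairwise_cons.1 hs
        rcases hp with rfl | hp
        · rcases List.mem_cons.1 hz with rfl | hz
          · exact .inl le_rfl
          · rcases List.mem_cons.1 hz with rfl | hz
            · exact .inr le_rfl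
            · exact .inr ((List.pairwise_cons.1 h2).1 z hz).le
        · rcases List.mem_cons.1 hz with rfl | hz
          · exact .inl (h1 _ (List.of_mem_zip (a := p.1) (b := p.2) hp).1).le
          · exact ih h2 hp z hz
  intro z hz
  exact key (U.sort (· ≤ ·)) U.sortedLT_sort.pairwise h z (by simpa using hz)

theorem eq_filter_append_filter_of_zip_tail {γ : Type*} (P : γ → Prop) [DecidablePred P] (l : List γ)
    (h : ∀ p ∈ l.zip l.tail, ¬ (¬ P p.1 ∧ P p.2)) :
    l = l.filter (fun c => P c) ++ l.filter (fun c => ¬ P c) ∧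
      (∀ a ∈ l.head?, ¬ P a → l.filter (fun c => P c) = []) := by
  induction l with
  | nil => simp
  | cons a l ih =>
    cases l with
    | nil => by_cases ha : P a <;> simp [ha]
    | cons b l =>
      have h1 := h (a, b) (by simp)
      have h2 := ih fun p hp => h p (by
        rw [List.tail_cons] at hp ⊢
        exact List.mem_cons_of_mem _ hp)
      by_cases ha : P a
      · refine ⟨?_, by simp [ha]⟩
        conv_lhs => rw [h2.1]
        simp only [List.filter_cons_of_pos (p := fun c => decide (P c)) (a := a) (by simpa using ha),
          List.filter_cons_of_neg (p := fun c => decide (¬ P c)) (a := a) (by simpa using ha),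
          List.cons_append]
      · have hb : ¬ P b := fun hb => h1 ⟨ha, hb⟩
        have h3 := h2.2 b (by simp) hb
        have h4 := h2.1
        rw [h3, List.nil_append] at h4
        have h5 : (a :: b :: l).filter (fun c => P c) = [] := by
          rw [List.filter_cons_of_neg (by simpa using ha), h3]
        refine ⟨?_, fun _ _ _ => h5⟩
        rw [h5, List.nil_append, List.filter_cons_of_pos (by simpa using ha), ← h4]

theorem sort_filter_eq (U : Finset α) (P : α → Prop) [DecidablePred P] :
    U.sort.filter (fun c => P c) = (U.filter P).sort := by
  refine List.Perm.eq_of_pairwise (le := (· ≤ ·)) (fun a b _ _ h1 h2 => le_antisymm h1 h2) ?_ ?_ ?_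
  · exact List.Pairwise.filter _ (U.sortedLT_sort.pairwise.imp le_of_lt)
  · exact (Finset.sortedLT_sort _).pairwise.imp le_of_lt
  · rw [List.perm_ext_iff_of_nodup ((Finset.sort_nodup _ _).filter _) (Finset.sort_nodup _ _)]
    simp

/-- A set which no standard row transposition lowers is an initial segment. -/
theorem sort_eq_of_rowTransposition_eq_none {U I : Finset α} (hI : I ⊆ U)
    (h : rowTransposition U I = none) :
    U.sort.take I.card = I.sort ∧ U.sort.drop I.card = (U \ I).sort := by
  have h1 := (eq_filter_append_filter_of_zip_tail (· ∈ I) U.sort (fun p hp => by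
    simpa using List.find?_eq_none.1 h p hp)).1
  rw [sort_filter_eq, sort_filter_eq, Finset.filter_mem_eq_inter, Finset.inter_eq_right.2 hI,
    ← Finset.sdiff_eq_filter] at h1
  rw [h1]
  have : I.card = I.sort.length := by simp
  exact ⟨by rw [this, List.take_left], by rw [this, List.drop_left]⟩

/-- A set which no standard column transposition raises is a final segment. -/
theorem sort_eq_of_colTransposition_eq_none {V J : Finset α} (hJ : J ⊆ V)
    (h : colTransposition V J = none) :
    V.sort.drop (V.card - J.card) = J.sort ∧ V.sort.take (V.card - J.card) = (V \ J).sort := by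
  have h1 := (eq_filter_append_filter_of_zip_tail (· ∉ J) V.sort (fun p hp => by
    simpa using List.find?_eq_none.1 h p (List.mem_reverse.2 hp))).1
  simp only [not_not] at h1
  rw [sort_filter_eq, sort_filter_eq, Finset.filter_mem_eq_inter, Finset.inter_eq_right.2 hJ,
    ← Finset.sdiff_eq_filter] at h1
  rw [h1]
  have : V.card - J.card = (V \ J).sort.length := by simp [Finset.card_sdiff_of_subset hJ]
  exact ⟨by rw [this, List.drop_left], by rw [this, List.take_left]⟩

theorem rowTower_of_none {U I : Finset α} (h : rowTransposition U I = none) :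
    rowTower U I = [] := by
  rw [rowTower]
  split <;> simp_all

theorem rowTower_of_some {U I : Finset α} {p : α × α} (h : rowTransposition U I = some p) :
    rowTower U I = p :: rowTower U (insert p.1 (I.erase p.2)) := by
  rw [rowTower]
  split <;> simp_all

theorem colTower_of_none {U I : Finset α} (h : colTransposition U I = none) :
    colTower U I = [] := by
  rw [colTower]
  split <;> simp_all

theorem colTower_of_some {U I : Finset α} {p : α × α} (h : colTransposition U I = some p) :
    colTower U I = p :: colTower U (insert p.2 (I.erase p.1)) := by
  rw [colTower]
  split <;> simp_all

theorem rowTransposition_mem {U I : Finset α} {p : α × α} (h : rowTransposition U I = some p) :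
    p ∈ consecutive U :=
  List.mem_of_find?_eq_some h

theorem colTransposition_mem {U I : Finset α} {p : α × α} (h : colTransposition U I = some p) :
    p ∈ consecutive U :=
  List.mem_reverse.1 (List.mem_of_find?_eq_some h)

theorem mem_of_mem_colTower {V J : Finset α} {p : α × α} (h : p ∈ colTower V J) :
    p.1 ∈ V ∧ p.2 ∈ V := by
  induction J using colTower.induct V with
  | case1 J h' => simp [colTower_of_none h'] at h
  | case2 J r h' ih =>
    rw [colTower_of_some h'] at h
    rcases List.mem_cons.1 h with rfl | h
    · exact ⟨(colTransposition_spec h').1, (colTransposition_spec h').2.1⟩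
    · exact ih h

/-! ### Inversions -/

theorem inversions_get_cons (c : α) (W : List α) :
    inversions (c :: W).get = W.countP (· < c) + inversions W.get := by
  have h1 : (Finset.univ.filter fun i : Fin W.length => W.get i < c).card = W.countP (· < c) := by
    induction W with
    | nil => simp
    | cons d W ih =>
      rw [Finset.card_filter] at ih ⊢
      have h2 := Fin.sum_univ_succ (n := W.length)
        (fun i : Fin (W.length + 1) => if (d :: W).get i < c then 1 else 0)
      refine h2.trans ?_
      rw [List.countP_cons, ← ih, add_comm]
      by_cases hd : d < c <;> simp [hd]
  exact (inversions_succ (m := W.length) (c :: W).get).trans (by rw [← h1]; rfl)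

theorem inversions_get_eq_zero {W : List α} (h : W.Pairwise (· < ·)) : inversions W.get = 0 := by
  rw [inversions, Finset.card_eq_zero, Finset.filter_eq_empty_iff]
  rintro ⟨i, j⟩ - ⟨h1, h2⟩
  exact h2.not_gt (List.pairwise_iff_get.1 h i j h1)

theorem inversions_map_swap_of_not_mem {a b : α} (hab : a < b) {W : List α}
    (hW : ∀ z ∈ W, z ≤ a ∨ b ≤ z) (h : ¬ (a ∈ W ∧ b ∈ W)) :
    inversions (W.map (Equiv.swap a b)).get = inversions W.get := by
  induction W with
  | nil => rfl
  | cons c W ih =>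
    rw [List.map_cons, inversions_get_cons, inversions_get_cons,
      ih (fun z hz => hW z (by simp [hz])) (by simp at h; tauto), List.countP_map]
    congr 1
    refine List.countP_congr fun z hz => ?_
    simp only [Function.comp_apply, decide_eq_true_eq]
    refine swap_lt_swap_iff hab (hW z (by simp [hz])) (hW c (by simp)) ?_ ?_
    · rintro ⟨rfl, rfl⟩
      exact h ⟨by simp [hz], by simp⟩
    · rintro ⟨rfl, rfl⟩
      exact h ⟨by simp, by simp [hz]⟩

theorem inversions_map_swap_of_sublist {a b : α} (hab : a < b) {W : List α} (hnd : W.Nodup)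
    (hW : ∀ z ∈ W, z ≤ a ∨ b ≤ z) (h : [a, b].Sublist W) :
    inversions (W.map (Equiv.swap a b)).get = inversions W.get + 1 := by
  induction W with
  | nil => simp at h
  | cons c W ih =>
    obtain ⟨hc, hnd⟩ := List.nodup_cons.1 hnd
    have hW' : ∀ z ∈ W, z ≤ a ∨ b ≤ z := fun z hz => hW z (by simp [hz])
    rw [List.map_cons, inversions_get_cons, inversions_get_cons, List.countP_map]
    by_cases h' : [a, b].Sublist W
    · rw [ih hnd hW' h', ← add_assoc]
      congr 2
      refine List.countP_congr fun z hz => ?_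
      simp only [Function.comp_apply, decide_eq_true_eq]
      have h1 : c ≠ a := by rintro rfl; exact hc (h'.subset (by simp))
      have h2 : c ≠ b := by rintro rfl; exact hc (h'.subset (by simp))
      exact swap_lt_swap_iff hab (hW' z hz) (hW c (by simp)) (by tauto) (by tauto)
    · have hca : a = c ∧ b ∈ W := by
        simpa [List.sublist_cons_iff, h'] using h
      obtain ⟨rfl, hb⟩ := hca
      rw [inversions_map_swap_of_not_mem hab hW' (by tauto)]
      obtain ⟨s, t, rfl⟩ := List.append_of_mem hb
      have hcong : ∀ u : List α, (∀ z ∈ u, z ∈ s ++ b :: t ∧ z ≠ b) →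
          u.countP ((fun z => decide (z < Equiv.swap a b a)) ∘ Equiv.swap a b) =
            u.countP (fun z => decide (z < a)) := by
        intro u hu
        refine List.countP_congr fun z hz => ?_
        simp only [Function.comp_apply, decide_eq_true_eq]
        exact swap_lt_swap_iff hab (hW' z (hu z hz).1) (.inl le_rfl) (fun h => hab.ne h.2)
          (fun h => (hu z hz).2 h.1)
      have hn : b ∉ s ∧ b ∉ t := by
        simp only [List.nodup_append, List.nodup_cons] at hnd
        grind
      rw [List.countP_append, List.countP_append, List.countP_cons, List.countP_cons,
        hcong s fun z hz => ⟨by simp [hz], fun h => hn.1 (h ▸ hz)⟩,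
        hcong t fun z hz => ⟨by simp [hz], fun h => hn.2 (h ▸ hz)⟩]
      simp [hab, hab.not_gt]
      ring

theorem inversions_map_swap_of_sublist' {a b : α} (hab : a < b) {W : List α} (hnd : W.Nodup)
    (hW : ∀ z ∈ W, z ≤ a ∨ b ≤ z) (h : [b, a].Sublist W) :
    inversions (W.map (Equiv.swap a b)).get + 1 = inversions W.get := by
  have h1 := inversions_map_swap_of_sublist hab (W := W.map (Equiv.swap a b))
    (hnd.map (Equiv.swap a b).injective) (fun z hz => by
      obtain ⟨y, hy, rfl⟩ := List.mem_map.1 hz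
      rw [Equiv.swap_apply_def]
      split_ifs
      · exact .inr le_rfl
      · exact .inl le_rfl
      · exact hW y hy) (by simpa using h.map (Equiv.swap a b))
  rw [← h1, List.map_map]
  have h2 : (Equiv.swap a b : α → α) ∘ Equiv.swap a b = id := funext fun c => by simp
  rw [h2, List.map_id]

end Towers

/-! ### Sums over the lists `C_i` -/

section Lists

theorem sum_map_filter_append_map {M T : Type*} [AddCommMonoid M] (l l' : List T)
    (P : T → Prop) [DecidablePred P] (act : T → T) (F : T → M) :
    ((l.filter (fun t => P t) ++ l'.map act).map F).sum =
      (l.map fun t => if P t then F t else 0).sum + (l'.map fun t => F (act t)).sum := by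
  rw [List.map_append, List.sum_append, List.map_map]
  congr 1
  induction l with
  | nil => simp
  | cons t l ih => by_cases h : P t <;> simp [h, ih]

/-- The recursion for the lists `C_i` in terms of the generating function `∑ μ ^ i C_i`. -/
theorem sum_range_lists {R M T : Type*} [CommRing R] [AddCommGroup M] [Module R M] (μ : R)
    (old new : ℕ → List T) (m : ℕ) (hold : old (m + 1) = []) (P : T → Prop) [DecidablePred P]
    (act : T → T) (h0 : new 0 = (old 0).map act)
    (hs : ∀ i, new (i + 1) = (old i).filter (fun t => P t) ++ (old (i + 1)).map act) (F : T → M) :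
    ∑ i ∈ Finset.range (m + 2), μ ^ i • ((new i).map F).sum =
      ∑ i ∈ Finset.range (m + 1),
        μ ^ i • ((old i).map fun t => F (act t) + if P t then μ • F t else 0).sum := by
  have h1 : ∀ i, ((old i).map fun t => F (act t) + if P t then μ • F t else 0).sum =
      ((old i).map fun t => F (act t)).sum +
        μ • ((old i).map fun t => if P t then F t else 0).sum := by
    intro i
    induction old i with
    | nil => simp
    | cons t l ih =>
      simp only [List.map_cons, List.sum_cons, ih, smul_add]
      split_ifs
      · abel
      · rw [smul_zero]
        abel
  have h2 : ∑ i ∈ Finset.range (m + 1), μ ^ i • ((old i).map fun t => F (act t)).sum =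
      ∑ i ∈ Finset.range (m + 2), μ ^ i • ((old i).map fun t => F (act t)).sum := by
    rw [Finset.sum_range_succ _ (m + 1), hold]
    simp
  simp only [h1, smul_add, Finset.sum_add_distrib]
  rw [h2, Finset.sum_range_succ', Finset.sum_range_succ' _ (m + 1), h0, List.map_map]
  simp only [hs, sum_map_filter_append_map, smul_add, Finset.sum_add_distrib, smul_smul, pow_succ]
  have h3 : (F ∘ act) = fun t => F (act t) := rfl
  rw [h3]
  abel

variable {α : Type*} [LinearOrder α]

theorem colC_eq_nil (t₀ : Index α) (τ : List (α × α)) {i : ℕ} (hi : τ.length < i) :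
    colC t₀ τ i = [] := by
  induction τ generalizing i with
  | nil =>
    obtain ⟨i, rfl⟩ := Nat.exists_eq_succ_of_ne_zero hi.ne'
    rfl
  | cons p τ ih =>
    obtain ⟨i, rfl⟩ := Nat.exists_eq_succ_of_ne_zero (Nat.ne_zero_of_lt hi)
    rw [List.length_cons] at hi
    rw [colC, ih (by omega), ih (by omega)]
    simp

theorem signedC_eq_nil (t₀ : Index α) (τ σ : List (α × α)) {i : ℕ}
    (hi : τ.length + σ.length < i) : signedC t₀ τ σ i = [] := by
  induction σ generalizing i with
  | nil =>
    rw [signedC, colC_eq_nil t₀ τ (by simpa using hi)]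
    rfl
  | cons p σ ih =>
    obtain ⟨i, rfl⟩ := Nat.exists_eq_succ_of_ne_zero (Nat.ne_zero_of_lt hi)
    rw [List.length_cons] at hi
    rw [signedC, ih (by omega), ih (by omega)]
    simp

/-- The rows of `t` are of lengths `r`, `r'`, and the columns of `t` are an arrangement of the
elements of `V` in sequences of lengths `m`, `m'`. -/
structure Index.IsSplit (V : Finset α) (r r' m m' : ℕ) (t : Index α) : Prop where
  row_length : t.row.length = r
  row'_length : t.row'.length = r'
  col_length : t.col.length = m
  col'_length : t.col'.length = m'
  nodup : (t.col ++ t.col').Nodup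
  mem_iff : ∀ c, c ∈ t.col ∨ c ∈ t.col' ↔ c ∈ V

theorem Index.IsSplit.rowAct {V : Finset α} {r r' m m' : ℕ} {t : Index α}
    (h : t.IsSplit V r r' m m') (p : α × α) : (t.rowAct p).IsSplit V r r' m m' :=
  ⟨by simpa [Index.rowAct] using h.1, by simpa [Index.rowAct] using h.2, h.3, h.4, h.5, h.6⟩

theorem Index.IsSplit.colAct {V : Finset α} {r r' m m' : ℕ} {t : Index α}
    (h : t.IsSplit V r r' m m') {p : α × α} (h1 : p.1 ∈ V) (h2 : p.2 ∈ V) :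
    (t.colAct p).IsSplit V r r' m m' := by
  refine ⟨h.1, h.2, by simpa [Index.colAct] using h.3, by simpa [Index.colAct] using h.4, ?_, ?_⟩
  · have := h.5.map (Equiv.swap p.1 p.2).injective
    rwa [List.map_append] at this
  · intro c
    have hm : ∀ W : List α, c ∈ W.map (Equiv.swap p.1 p.2) ↔ Equiv.swap p.1 p.2 c ∈ W := by
      intro W
      rw [List.mem_map]
      constructor
      · rintro ⟨d, hd, rfl⟩
        simpa using hd
      · intro hc
        exact ⟨_, hc, by simp⟩
    rw [Index.colAct, hm, hm, h.6, Equiv.swap_apply_def]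
    split_ifs with h3 h4
    · simp [h3, h1, h2]
    · simp [h4, h1, h2]
    · rfl

theorem isSplit_of_mem_colC {V : Finset α} {r r' m m' : ℕ} {t₀ : Index α}
    (h₀ : t₀.IsSplit V r r' m m') {τ : List (α × α)} (hτ : ∀ p ∈ τ, p.1 ∈ V ∧ p.2 ∈ V) {i : ℕ}
    {t : Index α} (ht : t ∈ colC t₀ τ i) :
    t.IsSplit V r r' m m' ∧ t.row = t₀.row ∧ t.row' = t₀.row' := by
  induction τ generalizing i t with
  | nil =>
    cases i with
    | zero =>
      obtain rfl : t = t₀ := by simpa [colC] using ht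
      exact ⟨h₀, rfl, rfl⟩
    | succ i => simp [colC] at ht
  | cons p τ ih =>
    have hτ' : ∀ p ∈ τ, p.1 ∈ V ∧ p.2 ∈ V := fun p hp => hτ p (by simp [hp])
    have hp := hτ p (by simp)
    have act : ∀ j, t ∈ (colC t₀ τ j).map (Index.colAct p) →
        t.IsSplit V r r' m m' ∧ t.row = t₀.row ∧ t.row' = t₀.row' := by
      intro j hj
      obtain ⟨s, hs, rfl⟩ := List.mem_map.1 hj
      obtain ⟨h1, h2⟩ := ih hτ' hs
      exact ⟨h1.colAct hp.1 hp.2, h2⟩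
    cases i with
    | zero => exact act 0 ht
    | succ i =>
      rcases List.mem_append.1 ht with h | h
      · exact ih hτ' (List.mem_filter.1 h).1
      · exact act _ h

theorem isSplit_of_mem_signedC {V : Finset α} {r r' m m' : ℕ} {t₀ : Index α}
    (h₀ : t₀.IsSplit V r r' m m') {τ : List (α × α)} (hτ : ∀ p ∈ τ, p.1 ∈ V ∧ p.2 ∈ V)
    (σ : List (α × α)) {i : ℕ} {y : ℤ × Index α} (hy : y ∈ signedC t₀ τ σ i) :
    y.2.IsSplit V r r' m m' := by
  induction σ generalizing i y with
  | nil =>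
    obtain ⟨t, ht, rfl⟩ := List.mem_map.1 hy
    exact (isSplit_of_mem_colC h₀ hτ ht).1
  | cons p σ ih =>
    have act : ∀ j, y ∈ (signedC t₀ τ σ j).map (fun y => (y.1, y.2.rowAct p)) →
        y.2.IsSplit V r r' m m' := by
      intro j hj
      obtain ⟨s, hs, rfl⟩ := List.mem_map.1 hj
      exact (ih hs).rowAct p
    cases i with
    | zero => exact act 0 hy
    | succ i =>
      rcases List.mem_append.1 hy with h | h
      · exact ih (List.mem_filter.1 h).1
      · exact act _ h

variable {R : Type*} [CommRing R]

/-- The column part of the summand that belongs to `t`. -/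
noncomputable def colTerm (p : R) (C : Finset α) (t : Index α) : List α →₀ R :=
  (-p) ^ (inversions t.col.get + inversions t.col'.get) •
    wedgePair p (t.col.toFinset ∪ C) (t.col'.toFinset ∪ C)

theorem swapSet_toFinset_union {a b : α} {C : Finset α} (ha : a ∉ C) (hb : b ∉ C) (W : List α) :
    swapSet a b (W.toFinset ∪ C) = (W.map (Equiv.swap a b)).toFinset ∪ C := by
  ext c
  rw [mem_swapSet, Finset.mem_union, Finset.mem_union, List.mem_toFinset, List.mem_toFinset,
    List.mem_map]
  refine or_congr ⟨fun h => ⟨_, h, by simp⟩, ?_⟩ ?_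
  · rintro ⟨d, hd, rfl⟩
    simpa using hd
  · rw [Equiv.swap_apply_def]
    split_ifs with h1 h2
    · simp [h1, ha, hb]
    · simp [h2, ha, hb]
    · rfl

/-- The column exchange operator acts on the summands as in the recursion for the lists `C_i`. -/
theorem exchange_colTerm {q p : R} (hqp : q * p = 1) {a b : α} (hab : a < b) {V C : Finset α}
    (ha : a ∈ V) (hb : b ∈ V) (hV : ∀ z ∈ V, z ≤ a ∨ b ≤ z) (hVC : Disjoint V C)
    {f : (List α →₀ R) →ₗ[R] (List α →₀ R)}
    (hf : ∀ X Y : Finset α, X ⊆ V ∪ C → Y ⊆ V ∪ C →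
      (∀ c ∈ V ∪ C, a < c → c < b → c ∈ X ∧ c ∈ Y) →
      ¬ (a ∈ X ↔ a ∈ Y) → ¬ (b ∈ X ↔ b ∈ Y) → f (wedgePair p X Y) = exchangePair q p a b X Y)
    {r r' m m' : ℕ} {t : Index α} (ht : t.IsSplit V r r' m m') :
    f (colTerm p C t) = colTerm p C (t.colAct (a, b)) +
      if ¬ [a, b].Sublist (t.col ++ t.col') then (-(p - q)) • colTerm p C t else 0 := by
  have haC : a ∉ C := Finset.disjoint_left.1 hVC ha
  have hbC : b ∉ C := Finset.disjoint_left.1 hVC hb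
  obtain ⟨hn1, hn2, hn3⟩ := List.nodup_append.1 ht.nodup
  have hdis : ∀ c ∈ t.col, c ∉ t.col' := fun c h h' => hn3 c h c h' rfl
  have hV1 : ∀ z ∈ t.col, z ≤ a ∨ b ≤ z := fun z hz => hV z ((ht.mem_iff z).1 (.inl hz))
  have hV2 : ∀ z ∈ t.col', z ≤ a ∨ b ≤ z := fun z hz => hV z ((ht.mem_iff z).1 (.inr hz))
  have ha' := (ht.mem_iff a).2 ha
  have hb' := (ht.mem_iff b).2 hb
  have memX : ∀ c, c ∉ C → ∀ W : List α, (c ∈ W.toFinset ∪ C ↔ c ∈ W) := fun c hc W => by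
    simp [hc]
  have hX : t.col.toFinset ∪ C ⊆ V ∪ C :=
    Finset.union_subset_union_left fun c hc => (ht.mem_iff c).1 (.inl (List.mem_toFinset.1 hc))
  have hY : t.col'.toFinset ∪ C ⊆ V ∪ C :=
    Finset.union_subset_union_left fun c hc => (ht.mem_iff c).1 (.inr (List.mem_toFinset.1 hc))
  have hfX : f (wedgePair p (t.col.toFinset ∪ C) (t.col'.toFinset ∪ C)) =
      exchangePair q p a b (t.col.toFinset ∪ C) (t.col'.toFinset ∪ C) := by
    refine hf _ _ hX hY ?_ ?_ ?_
    · intro c hc h1 h2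
      rcases Finset.mem_union.1 hc with h | h
      · rcases hV c h with h' | h'
        · exact absurd h1 h'.not_gt
        · exact absurd h2 h'.not_gt
      · simp [h]
    · rw [memX a haC, memX a haC]
      have := hdis a
      tauto
    · rw [memX b hbC, memX b hbC]
      have := hdis b
      tauto
  have hact : colTerm p C (t.colAct (a, b)) =
      (-p) ^ (inversions (t.col.map (Equiv.swap a b)).get +
        inversions (t.col'.map (Equiv.swap a b)).get) •
        wedgePair p (swapSet a b (t.col.toFinset ∪ C)) (swapSet a b (t.col'.toFinset ∪ C)) := by
    rw [swapSet_toFinset_union haC hbC, swapSet_toFinset_union haC hbC]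
    rfl
  have hinv : ∀ W : List α, W.Nodup → (∀ z ∈ W, z ≤ a ∨ b ≤ z) → a ∈ W → b ∈ W →
      if [a, b].Sublist W then
        inversions (W.map (Equiv.swap a b)).get = inversions W.get + 1
      else inversions (W.map (Equiv.swap a b)).get + 1 = inversions W.get := by
    intro W h1 h2 h3 h4
    split_ifs with h
    · exact inversions_map_swap_of_sublist hab h1 h2 h
    · exact inversions_map_swap_of_sublist' hab h1 h2
        (by rw [pair_sublist_iff_not hab.ne' h1 h4 h3]; exact h)
  have hkey : -p * (-p) = 1 + (-(p - q)) * -p := by linear_combination hqp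
  rw [hact, colTerm, map_smul, hfX, exchangePair]
  simp only [memX a haC, memX b hbC]
  rcases ha' with ha1 | ha2 <;> rcases hb' with hb1 | hb2
  · -- both columns lie in the first minor
    have ha2 := hdis a ha1
    have hb2 := hdis b hb1
    have hsub : [a, b].Sublist (t.col ++ t.col') ↔ [a, b].Sublist t.col := by
      by_cases h : [a, b].Sublist t.col
      · exact iff_of_true (h.trans (List.sublist_append_left _ _)) h
      · refine iff_of_false ?_ h
        rw [pair_sublist_iff_not hab.ne hn1 ha1 hb1, not_not] at h
        rw [pair_sublist_iff_not hab.ne ht.nodup (by simp [ha1]) (by simp [hb1]), not_not]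
        exact h.trans (List.sublist_append_left _ _)
    have h1 := hinv _ hn1 hV1 ha1 hb1
    rw [inversions_map_swap_of_not_mem hab hV2 (by tauto), if_pos (by tauto),
      swapSet_eq_self (by simp [ha1, hb1]), swapSet_eq_self (by simp [ha2, hb2, haC, hbC])]
    by_cases h : [a, b].Sublist t.col
    · rw [if_pos h] at h1
      rw [h1, if_neg (by simp [hsub, h])]
      match_scalars
      ring
    · rw [if_neg h] at h1
      rw [← h1, if_pos (hsub.not.2 h)]
      match_scalars
      linear_combination ((-p) ^ (inversions (t.col.map (Equiv.swap a b)).get +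
        inversions t.col'.get)) * hkey
  · have ha2 := hdis a ha1
    have hb1 : b ∉ t.col := fun h => hdis b h hb2
    have hsub : [a, b].Sublist (t.col ++ t.col') :=
      List.Sublist.append (l₁ := [a]) (r₁ := [b]) (by simpa) (by simpa)
    rw [inversions_map_swap_of_not_mem hab hV2 (by tauto),
      inversions_map_swap_of_not_mem hab hV1 (by tauto), if_neg (by tauto), if_pos ha1,
      if_neg (by simp [hsub]), sub_zero, add_zero]
  · have ha1 : a ∉ t.col := fun h => hdis a h ha2
    have hb2 := hdis b hb1
    have hsub : ¬ [a, b].Sublist (t.col ++ t.col') := by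
      rw [pair_sublist_iff_not hab.ne ht.nodup (by simp [ha2]) (by simp [hb1]), not_not]
      exact List.Sublist.append (l₁ := [b]) (r₁ := [a]) (by simpa) (by simpa)
    rw [inversions_map_swap_of_not_mem hab hV2 (by tauto),
      inversions_map_swap_of_not_mem hab hV1 (by tauto), if_neg (by tauto), if_neg ha1,
      if_pos hsub]
    module
  · -- both columns lie in the second minor
    have ha1 : a ∉ t.col := fun h => hdis a h ha2
    have hb1 : b ∉ t.col := fun h => hdis b h hb2
    have hsub : [a, b].Sublist (t.col ++ t.col') ↔ [a, b].Sublist t.col' := by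
      by_cases h : [a, b].Sublist t.col'
      · exact iff_of_true (h.trans (List.sublist_append_right _ _)) h
      · refine iff_of_false ?_ h
        rw [pair_sublist_iff_not hab.ne hn2 ha2 hb2, not_not] at h
        rw [pair_sublist_iff_not hab.ne ht.nodup (by simp [ha2]) (by simp [hb2]), not_not]
        exact h.trans (List.sublist_append_right _ _)
    have h1 := hinv _ hn2 hV2 ha2 hb2
    rw [inversions_map_swap_of_not_mem hab hV1 (by tauto), if_pos (by tauto),
      swapSet_eq_self (by simp [ha1, hb1, haC, hbC]), swapSet_eq_self (by simp [ha2, hb2])]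
    by_cases h : [a, b].Sublist t.col'
    · rw [if_pos h] at h1
      rw [h1, if_neg (by simp [hsub, h])]
      match_scalars
      ring
    · rw [if_neg h] at h1
      rw [← h1, if_pos (hsub.not.2 h)]
      match_scalars
      linear_combination ((-p) ^ (inversions t.col.get +
        inversions (t.col'.map (Equiv.swap a b)).get)) * hkey

end Lists

/-! ### Descent along the towers -/

section Intertwining

variable {R α : Type*} [CommRing R] [LinearOrder α] {q p : R}

theorem sdiff_union_eq_swapSet {a b : α} {V C J : Finset α} (ha : a ∈ V) (hb : b ∈ V)
    (hVC : Disjoint V C) (haJ : a ∈ J) (hbJ : b ∉ J) :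
    swapSet a b ((V \ insert b (J.erase a)) ∪ C) = (V \ J) ∪ C ∧
      swapSet a b (insert b (J.erase a) ∪ C) = J ∪ C := by
  have haC : a ∉ C := Finset.disjoint_left.1 hVC ha
  have hbC : b ∉ C := Finset.disjoint_left.1 hVC hb
  have hab : a ≠ b := by rintro rfl; exact hbJ haJ
  constructor <;> ext c <;> rw [mem_swapSet, Equiv.swap_apply_def] <;> split_ifs with h1 h2 <;>
    simp [*]

theorem smodEq_of_eq {M : Type*} [AddCommGroup M] [Module R M] {S : Submodule R M} {x y : M}
    (h : x = y) : x ≡ y [SMOD S] :=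
  h ▸ SModEq.rfl

theorem isSplit_baseIndex (U V : Finset α) (r m : ℕ) :
    (baseIndex U V r m).IsSplit V (min r U.card) (U.card - r) (V.card - (V.card - m))
      (min (V.card - m) V.card) := by
  refine ⟨by simp [baseIndex], by simp [baseIndex], by simp [baseIndex], by simp [baseIndex], ?_,
    fun c => ?_⟩
  · refine (List.Perm.nodup_iff ?_).2 (Finset.sort_nodup V (· ≤ ·))
    exact List.perm_append_comm.trans (by rw [baseIndex, List.take_append_drop])
  · rw [or_comm, ← List.mem_append, baseIndex, List.take_append_drop, Finset.mem_sort]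

variable {β : Type*} [LinearOrder β] {U : Set β}

/-- The identity for a product of minors `[K, (V \ J) ∪ C] [Z, J ∪ C]` in which all rows in `K` are
larger than those in `Z`, so that only the column tower matters. Each step of the column tower is
the action of one column operator. The rows of the base index are irrelevant here. -/
theorem mono_wedgePair_eq_sum_colC (hqp : q * p = 1) {K Z : List β} {V C J : Finset α}
    (hVC : Disjoint V C) (hJV : J ⊆ V) (hnd : (K ++ Z).Nodup) (hU : ∀ z ∈ K ++ Z, z ∈ U)
    (hk : ∀ k ∈ K, ∀ z ∈ Z, z < k) (hZ : (J ∪ C).card = Z.length)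
    (hK : ((V \ J) ∪ C).card = K.length) (W : Finset α) (r m : ℕ) (hm : J.card = m) :
    mono (K ++ Z) (wedgePair p ((V \ J) ∪ C) (J ∪ C)) ≡
      q ^ C.card • ∑ i ∈ Finset.range ((colTower V J).length + 1), (-(p - q)) ^ i •
        ((colC (baseIndex W V r m) (colTower V J) i).map fun t => mono (Z ++ K) (colTerm p C t)).sum
      [SMOD relations q p U ((V ∪ C : Finset α) : Set α)] := by
  induction J using colTower.induct V with
  | case1 J h =>
    -- `J` is a final segment of `V`: the two minors `q`-commute
    obtain ⟨h1, h2⟩ := sort_eq_of_colTransposition_eq_none hJV h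
    rw [hm] at h1 h2
    have hcol : (baseIndex W V r m).col = J.sort := h1
    have hcol' : (baseIndex W V r m).col' = (V \ J).sort := h2
    have h3 := mono_wedgePair (Q := V ∪ C) hqp hnd hU hk (L := (V \ J) ∪ C) (J := J ∪ C) (by
      rw [← Finset.union_union_distrib_right, Finset.sdiff_union_of_subset hJV]) (by
      intro l hl hlJ j hj hjL
      simp only [Finset.mem_union, Finset.mem_sdiff, not_or] at hl hlJ hj hjL
      have hl' : l ∈ V.sort.take (V.card - m) := by
        rw [h2, Finset.mem_sort, Finset.mem_sdiff]
        tauto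
      have hj' : j ∈ V.sort.drop (V.card - m) := by
        rw [h1, Finset.mem_sort]
        tauto
      have hs := V.sortedLT_sort.pairwise
      rw [← List.take_append_drop (V.card - m) (V.sort (· ≤ ·))] at hs
      exact (List.pairwise_append.1 hs).2.2 l hl' j hj') hZ hK
    have h4 : ((V \ J) ∪ C) ∩ (J ∪ C) = C := by
      rw [← Finset.inter_union_distrib_right, Finset.sdiff_inter_self, Finset.empty_union]
    rw [h4] at h3
    rw [colTower_of_none h]
    have h5 : ∀ X : Finset α, inversions X.sort.get = 0 := fun X =>
      inversions_get_eq_zero X.sortedLT_sort.pairwise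
    have h6 : inversions (baseIndex W V r m).col.get = 0 := by
      rw [hcol]
      exact h5 J
    have h7 : inversions (baseIndex W V r m).col'.get = 0 := by
      rw [hcol']
      exact h5 (V \ J)
    simpa [colC, colTerm, h6, h7, hcol, hcol'] using h3
  | case2 J s h ih =>
    -- the operator that exchanges the columns `a`, `b` turns the identity for the set in which `a` is
    -- replaced by `b` into the identity for `J`
    obtain ⟨a, b⟩ := s
    obtain ⟨ha, hb, hab, haJ, hbJ⟩ := colTransposition_spec h
    have hV := le_or_le_of_mem_consecutive (colTransposition_mem h)
    simp only at ha hb hab haJ hbJ hV ih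
    have haC : a ∉ C := Finset.disjoint_left.1 hVC ha
    have hbC : b ∉ C := Finset.disjoint_left.1 hVC hb
    obtain ⟨hs1, hs2⟩ := sdiff_union_eq_swapSet ha hb hVC haJ hbJ
    have hcard : (insert b (J.erase a)).card = J.card := by
      rw [Finset.card_insert_of_notMem (by simp [hbJ]), Finset.card_erase_add_one haJ]
    obtain ⟨f, hf, hfw⟩ := exists_exchange hqp (V ∪ C) hab (Finset.mem_union_left C ha)
      (Finset.mem_union_left C hb)
    have h1 := ih (Finset.insert_subset hb ((Finset.erase_subset _ _).trans hJV))
      (by rw [← hZ, ← hs2, card_swapSet]) (by rw [← hK, ← hs1, card_swapSet])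
      (by rw [hcard, hm])
    have h2 := colOperator_smodEq hf h1
    have h3 : f (wedgePair p ((V \ insert b (J.erase a)) ∪ C) (insert b (J.erase a) ∪ C)) =
        wedgePair p ((V \ J) ∪ C) (J ∪ C) := by
      rw [hfw, exchangePair, hs1, hs2, if_neg, if_pos, sub_zero]
      · simp [ha, hab.ne]
      · simp [ha, hab.ne, haC, hbC]
      · exact Finset.union_subset_union_left Finset.sdiff_subset
      · exact Finset.union_subset_union_left
          (Finset.insert_subset hb ((Finset.erase_subset _ _).trans hJV))
      · intro c hc h1 h2
        rcases Finset.mem_union.1 hc with h | h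
        · rcases hV c h with h' | h'
          · exact absurd h1 h'.not_gt
          · exact absurd h2 h'.not_gt
        · simp [h]
      · simp [ha, hab.ne, haC]
      · simp [hbC]
    rw [colOperator_mono, h3] at h2
    refine h2.trans ?_
    rw [map_smul, map_sum, colTower_of_some h, List.length_cons,
      sum_range_lists (-(p - q)) (colC (baseIndex W V r m) (colTower V (insert b (J.erase a))))
        (colC (baseIndex W V r m) ((a, b) :: colTower V (insert b (J.erase a)))) _
        (colC_eq_nil _ _ (Nat.lt_succ_self _))
        (fun t => ¬ [a, b].Sublist (t.col ++ t.col')) (Index.colAct (a, b)) rfl (fun i => rfl)]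
    refine smodEq_of_eq ?_
    congr 1
    refine Finset.sum_congr rfl fun i _ => ?_
    rw [map_smul, map_list_sum, List.map_map]
    congr 2
    refine List.map_congr_left fun t ht => ?_
    have h4 := (isSplit_of_mem_colC (isSplit_baseIndex W V r m) (fun _ => mem_of_mem_colTower) ht).1
    rw [Function.comp_apply, colOperator_mono, exchange_colTerm hqp hab ha hb hV hVC hfw h4]
    split_ifs <;> simp

/-- The summand that belongs to a member of the list `C_i`. -/
noncomputable def signedTerm (p : R) (C : Finset α) (y : ℤ × Index α) : RowColModule R α α :=
  (y.1 : R) • mono (y.2.row ++ y.2.row') (colTerm p C y.2)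

theorem map_swap_sort {a b : α} {U I : Finset α} (hU : ∀ z ∈ U, z ≤ a ∨ b ≤ z) (hab : a < b)
    (hI : I ⊆ U) (h : ¬ (a ∈ I ∧ b ∈ I)) :
    I.sort.map (Equiv.swap a b) = (swapSet a b I).sort := by
  refine List.Perm.eq_of_pairwise (le := (· ≤ ·)) (fun a b _ _ h1 h2 => le_antisymm h1 h2) ?_ ?_ ?_
  · rw [List.pairwise_map]
    refine List.Pairwise.imp_of_mem ?_ I.sortedLT_sort.pairwise
    intro c d hc hd hcd
    rw [Finset.mem_sort] at hc hd
    exact ((swap_lt_swap_iff hab (hU c (hI hc)) (hU d (hI hd))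
      (by rintro ⟨rfl, rfl⟩; exact h ⟨hc, hd⟩) (by rintro ⟨rfl, rfl⟩; exact h ⟨hd, hc⟩)).2 hcd).le
  · exact (Finset.sortedLT_sort _).pairwise.imp le_of_lt
  · rw [List.perm_ext_iff_of_nodup ((Finset.sort_nodup _ _).map (Equiv.swap a b).injective)
      (Finset.sort_nodup _ _)]
    intro c
    rw [Finset.mem_sort, mem_swapSet, List.mem_map]
    constructor
    · rintro ⟨d, hd, rfl⟩
      simpa using hd
    · intro hc
      exact ⟨_, by simpa using hc, by simp⟩

/-- The identity modulo the relations. Each step of the row tower is the action of one row exchange,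
and the case of an initial segment `I` is `mono_wedgePair_eq_sum_colC`. -/
theorem mono_wedgePair_eq_sum_signedC (hqp : q * p = 1) {U I V C J : Finset α}
    (hVC : Disjoint V C) (hJV : J ⊆ V) (hIU : I ⊆ U) (hI : (J ∪ C).card = I.card)
    (hK : ((V \ J) ∪ C).card = (U \ I).card) :
    mono ((U \ I).sort ++ I.sort) (wedgePair p ((V \ J) ∪ C) (J ∪ C)) ≡
      q ^ C.card • ∑ i ∈ Finset.range ((colTower V J).length + (rowTower U I).length + 1),
        (p - q) ^ i • ((signedC (baseIndex U V I.card J.card) (colTower V J)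
          (rowTower U I) i).map (signedTerm p C)).sum
      [SMOD relations q p (U : Set α) ((V ∪ C : Finset α) : Set α)] := by
  induction I using rowTower.induct U with
  | case1 I h =>
    obtain ⟨h1, h2⟩ := sort_eq_of_rowTransposition_eq_none hIU h
    have hrow : (baseIndex U V I.card J.card).row = I.sort := h1
    have hrow' : (baseIndex U V I.card J.card).row' = (U \ I).sort := h2
    have hsorted : (I.sort ++ (U \ I).sort).Pairwise (· < ·) := by
      rw [← h1, ← h2, List.take_append_drop]
      exact U.sortedLT_sort.pairwise
    have h3 := mono_wedgePair_eq_sum_colC (U := (U : Set α)) hqp (K := (U \ I).sort)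
      (Z := I.sort) hVC hJV ?_ ?_ ?_ (by simpa using hI) (by simpa using hK) U
      I.card J.card rfl
    · refine h3.trans (smodEq_of_eq ?_)
      rw [rowTower_of_none h, List.length_nil, add_zero]
      congr 1
      refine Finset.sum_congr rfl fun i _ => ?_
      rw [signedC, List.map_map, neg_pow, mul_comm, mul_smul]
      congr 1
      rw [List.smul_sum, List.map_map]
      congr 1
      refine List.map_congr_left fun t ht => ?_
      obtain ⟨-, h4, h5⟩ := isSplit_of_mem_colC (isSplit_baseIndex _ _ _ _) (fun _ => mem_of_mem_colTower) ht
      simp [signedTerm, h4, h5, hrow, hrow']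
    · refine (List.Perm.nodup_iff List.perm_append_comm).1 ?_
      exact hsorted.imp ne_of_lt
    · intro z hz
      simp only [List.mem_append, Finset.mem_sort, Finset.mem_sdiff] at hz
      rcases hz with hz | hz
      exacts [hz.1, hIU hz]
    · intro k hk z hz
      exact (List.pairwise_append.1 hsorted).2.2 z hz k hk
  | case2 I r h ih =>
    obtain ⟨a, b⟩ := r
    obtain ⟨ha, hb, hab, haI, hbI⟩ := rowTransposition_spec h
    have hU := le_or_le_of_mem_consecutive (rowTransposition_mem h)
    simp only at ha hb hab haI hbI hU ih
    have hcard : (insert a (I.erase b)).card = I.card := by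
      rw [Finset.card_insert_of_notMem (by simp [haI]), Finset.card_erase_add_one hbI]
    have hI' : insert a (I.erase b) ⊆ U :=
      Finset.insert_subset ha ((Finset.erase_subset _ _).trans hIU)
    have h1 := ih hI' (by rw [hI, hcard])
      (by rw [hK, Finset.card_sdiff_of_subset hIU, Finset.card_sdiff_of_subset hI', hcard])
    have h2 := rowExchange_smodEq hqp hab ha hb hU h1
    have hs : [b, a].Sublist ((U \ insert a (I.erase b)).sort ++ (insert a (I.erase b)).sort) :=
      List.Sublist.append (l₁ := [b]) (r₁ := [a]) (by simp [hb, hab.ne']) (by simp)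
    have e : (U \ insert a (I.erase b)).sort.map (Equiv.swap a b) = (U \ I).sort ∧
        (insert a (I.erase b)).sort.map (Equiv.swap a b) = I.sort := by
      obtain ⟨h5, h6⟩ := sdiff_union_eq_swapSet hb ha (Finset.disjoint_empty_right U) hbI haI
      rw [Finset.union_empty, Finset.union_empty, swapSet_comm] at h5 h6
      rw [map_swap_sort hU hab Finset.sdiff_subset (by simp), h5, map_swap_sort hU hab hI', h6]
      · exact ⟨rfl, rfl⟩
      · simp [hab.ne']
    rw [rowExchange_single, if_pos hs, add_zero, List.map_append, e.1, e.2] at h2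
    refine h2.trans (smodEq_of_eq ?_)
    rw [map_smul, map_sum, rowTower_of_some h, List.length_cons, hcard, ← add_assoc,
      sum_range_lists (p - q)
        (signedC (baseIndex U V I.card J.card) (colTower V J) (rowTower U (insert a (I.erase b))))
        (signedC (baseIndex U V I.card J.card) (colTower V J)
          ((a, b) :: rowTower U (insert a (I.erase b)))) _
        (signedC_eq_nil _ _ _ (Nat.lt_succ_self _))
        (fun y => ¬ [b, a].Sublist (y.2.row ++ y.2.row')) (fun y => (y.1, y.2.rowAct (a, b))) rfl
        (fun i => rfl)]
    congr 1
    refine Finset.sum_congr rfl fun i _ => ?_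
    rw [map_smul, map_list_sum, List.map_map]
    congr 2
    refine List.map_congr_left fun y _ => ?_
    rw [Function.comp_apply, signedTerm, map_smul, rowExchange_single, List.map_append, smul_add]
    congr 1
    by_cases hy : [b, a].Sublist (y.2.row ++ y.2.row')
    · rw [if_pos hy, if_neg (by simpa using hy), smul_zero]
    · rw [if_neg hy, if_pos hy, smul_comm]

end Intertwining
end QuantumMinor

theorem mainTheorem3 (k : Type*) [Field k] (n : ℕ) (I J K L : Finset (Fin n))
    (hIJ : I.card = J.card) (hKL : K.card = L.card) (hIK : Disjoint I K) :
    (LaurentPolynomial.T (-((J ∩ L).card : ℤ)) : LaurentPolynomial k) •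
        (QuantumMinor.minor k K.sort L * QuantumMinor.minor k I.sort J) =
      ∑ i ∈ Finset.range
          ((QuantumMinor.colTower ((J ∪ L) \ (J ∩ L)) (J \ (J ∩ L))).length +
            (QuantumMinor.rowTower (I ∪ K) I).length + 1),
        (LaurentPolynomial.T (-1) - LaurentPolynomial.T 1 : LaurentPolynomial k) ^ i •
          ((QuantumMinor.C (I ∪ K) ((J ∪ L) \ (J ∩ L)) I (J \ (J ∩ L)) i).map fun y =>
            ((y.1 : LaurentPolynomial k) *
                (-(LaurentPolynomial.T (-1))) ^
                  (QuantumMinor.inversions y.2.col.get + QuantumMinor.inversions y.2.col'.get)) •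
              (QuantumMinor.minor k y.2.row (y.2.col.toFinset ∪ (J ∩ L)) *
                QuantumMinor.minor k y.2.row' (y.2.col'.toFinset ∪ (J ∩ L)))).sum := by
  set C := J ∩ L with hC
  set V := (J ∪ L) \ C with hV
  have hVC : Disjoint V C := Finset.sdiff_disjoint
  have hJV : J \ C ⊆ V := Finset.sdiff_subset_sdiff Finset.subset_union_left le_rfl
  have hJ : J \ C ∪ C = J := Finset.sdiff_union_of_subset Finset.inter_subset_left
  have hL : V \ (J \ C) ∪ C = L := by
    ext c
    simp only [hV, hC, Finset.mem_union, Finset.mem_sdiff, Finset.mem_inter]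
    tauto
  have hK : (I ∪ K) \ I = K := by
    rw [Finset.union_sdiff_left, Finset.sdiff_eq_self_of_disjoint hIK.symm]
  have h := QuantumMinor.mono_wedgePair_eq_sum_signedC (U := I ∪ K) (I := I) (V := V) (C := C)
    (J := J \ C) (QuantumMinor.T_one_mul_T_neg_one k) hVC hJV Finset.subset_union_left
    (by rw [hJ, hIJ]) (by rw [hL, hK, hKL])
  rw [hJ, hL, hK, SModEq.sub_mem] at h
  have h1 := QuantumMinor.evalMono_eq_zero k h
  rw [map_sub, sub_eq_zero, QuantumMinor.evalMono_wedgePair k (by simp [hKL]) (by simp [hIJ]),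
    map_smul, map_sum] at h1
  have hT : (LaurentPolynomial.T (-(C.card : ℤ)) : LaurentPolynomial k) *
      LaurentPolynomial.T 1 ^ C.card = 1 := by
    rw [LaurentPolynomial.T_pow, ← LaurentPolynomial.T_add]
    simp
  rw [h1, smul_smul, hT, one_smul]
  refine Finset.sum_congr rfl fun i _ => ?_
  rw [map_smul, map_list_sum, List.map_map]
  congr 2
  refine List.map_congr_left fun y hy => ?_
  have hy' := QuantumMinor.isSplit_of_mem_signedC (QuantumMinor.isSplit_baseIndex _ _ _ _)
    (fun _ => QuantumMinor.mem_of_mem_colTower) _ hy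
  obtain ⟨hn1, hn2, -⟩ := List.nodup_append.1 hy'.nodup
  have hdis : ∀ W : List (Fin n), (∀ c ∈ W, c ∈ V) → W.Nodup →
      (W.toFinset ∪ C).card = W.length + C.card := by
    intro W h1 h2
    rw [Finset.card_union_of_disjoint, List.toFinset_card_of_nodup h2]
    exact Finset.disjoint_left.2 fun c hc => Finset.disjoint_left.1 hVC (h1 c (by simpa using hc))
  have hc1 := hdis y.2.col (fun c hc => (hy'.mem_iff c).1 (.inl hc)) hn1
  have hc2 := hdis y.2.col' (fun c hc => (hy'.mem_iff c).1 (.inr hc)) hn2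
  have hIU : I.card ≤ (I ∪ K).card := Finset.card_le_card Finset.subset_union_left
  have hJc : (J \ C).card + C.card = J.card :=
    Finset.card_sdiff_add_card_eq_card Finset.inter_subset_left
  have hLc : (V \ (J \ C)).card + C.card = L.card := by
    rw [← Finset.card_union_of_disjoint (hVC.mono_left Finset.sdiff_subset), hL]
  have hVc := Finset.card_sdiff_add_card_eq_card hJV
  have hUc : (I ∪ K).card = I.card + K.card := Finset.card_union_of_disjoint hIK
  rw [Function.comp_apply, QuantumMinor.signedTerm, QuantumMinor.colTerm, map_smul, map_smul,
    map_smul, QuantumMinor.evalMono_wedgePair, smul_smul]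
  · rw [hc1, hy'.col_length, hy'.row_length]
    omega
  · rw [hc2, hy'.col'_length, hy'.row'_length]
    omega
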